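/- Conventions. A countable Borel equivalence relation (CBER) is an equivalence relation $E$ with countable classes on a standard Borel space $X$ that is Borel as a subset of $X^2$. It is aperiodic if every class is infinite; hyperfinite if $E=\bigcup_n E_n$ for an increasing sequence of Borel equivalence relations $E_n$ with finite classes; compressible if there is a Borel injection $T\colon X\to X$ with $T([x]_E)\subsetneq [x]_E$ for every $x$. Write $E\cong_B F$ if some Borel bijection between the underlying spaces takes $E$ to $F$. Let $E\oplus F$ be the direct sum on the disjoint union, and let $E\times I_{\mathbb N}$ be the relation on $X\times\mathbb N$ given by $(x,m)\sim(y,n)\iff x\mathrel E y$. Let $\mathrm{Aut}_B(E)$ be the group of Borel automorphisms $T$ of $X$ with $x\mathrel E y\iff T(x)\mathrel E T(y)$. A permutation $f$ of $X/E$ is Borel if $\{(x,y)\in X^2: f([x]_E)=[y]_E\}$ is Borel, and outer if there is $T\in\mathrm{Aut}_B(E)$ with $f([x]_E)=[T(x)]_E$ for all $x$. A Borel action on $X/E$ is an action of a countable group $G$ on $X/E$ by Borel permutations; it is outer if every $g\in G$ acts by an outer permutation. A lift of it is a homomorphism $G\to\mathrm{Aut}_B(E)$, that is, an action of $G$ on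 $X$ by Borel automorphisms of $E$, such that $g\cdot[x]_E=[g\cdot x]_E$ for all $g\in G$ and $x\in X$. The lift is class-bijective if $g\cdot x\mathrel E x$ implies $g\cdot x=x$. Corollary. Let $E$ be an aperiodic CBER on $X$. Suppose that $E\cong_B E\oplus(E\times I_{\mathbb N})$ or that $E$ is hyperfinite. Then the following are equivalent: (1) Every Borel action on $X/E$ has a class-bijective lift. (2) Every Borel action on $X/E$ has a lift. (3) Every Borel action on $X/E$ is outer. (4) There is a nontrivial countable group $G$ such that every Borel action of $G$ on $X/E$ is outer. (5) $E$ is compressible. Moreover, every aperiodic hyperfinite CBER $E$ for which $X/E$ is infinite or empty satisfies $E\cong_B E\oplus(E\times I_{\mathbb N})$. -/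

import Mathlib

namespace CBER

/-- `E` is a countable Borel equivalence relation: it is Borel as a subset of the square, and all
its classes are countable. -/
structure IsCBER {X : Type*} [MeasurableSpace X] (E : Setoid X) : Prop where
  measurableSet_graph : MeasurableSet {p : X × X | E p.1 p.2}
  countable_class : ∀ x : X, {y : X | E x y}.Countable

/-- Every equivalence class is infinite. -/
def IsAperiodic {X : Type*} (E : Setoid X) : Prop :=
  ∀ x : X, {y : X | E x y}.Infinite

/-- `E` is the union of an increasing sequence of Borel equivalence relations with finite
classes. -/
def IsHyperfinite {X : Type*} [MeasurableSpace X] (E : Setoid X) : Prop :=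
  ∃ F : ℕ → Setoid X,
    (∀ n, MeasurableSet {p : X × X | F n p.1 p.2}) ∧
    (∀ n x, {y : X | F n x y}.Finite) ∧
    (∀ n x y, F n x y → F (n + 1) x y) ∧
    (∀ x y, E x y ↔ ∃ n, F n x y)

/-- There is a Borel injection mapping every equivalence class to a proper subset of itself. -/
def IsCompressible {X : Type*} [MeasurableSpace X] (E : Setoid X) : Prop :=
  ∃ T : X → X, Measurable T ∧ Function.Injective T ∧
    ∀ x : X, T '' {y : X | E x y} ⊂ {y : X | E x y}

/-- Borel isomorphism of equivalence relations. -/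
def BorelIso {X Y : Type*} [MeasurableSpace X] [MeasurableSpace Y]
    (E : Setoid X) (F : Setoid Y) : Prop :=
  ∃ T : X ≃ᵐ Y, ∀ x x' : X, E x x' ↔ F (T x) (T x')

/-- The direct sum `E ⊕ F` on the disjoint union: it agrees with `E` on `X` and with `F` on `Y`,
and no point of `X` is related to a point of `Y`. -/
def directSum {X Y : Type*} (E : Setoid X) (F : Setoid Y) : Setoid (X ⊕ Y) where
  r := Sum.LiftRel E F
  iseqv :=
    { refl := by
        rintro (x | y)
        · exact Sum.LiftRel.inl (E.refl x)
        · exact Sum.LiftRel.inr (F.refl y)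
      symm := by
        rintro _ _ (h | h)
        · exact Sum.LiftRel.inl (E.symm h)
        · exact Sum.LiftRel.inr (F.symm h)
      trans := by
        rintro _ _ _ (h | h) (h' | h')
        · exact Sum.LiftRel.inl (E.trans h h')
        · exact Sum.LiftRel.inr (F.trans h h') }

/-- The relation `E × I_ℕ` on `X × ℕ`, where `I_ℕ` relates all natural numbers. -/
def prodNat {X : Type*} (E : Setoid X) : Setoid (X × ℕ) :=
  E.prod ⊤

/-- The group of Borel automorphisms of `E`: permutations of `X`, Borel together with their
inverses, under which two points are `E`-related exactly when their images are. -/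
def autB {X : Type*} [MeasurableSpace X] (E : Setoid X) : Subgroup (Equiv.Perm X) where
  carrier := {T | Measurable T ∧ Measurable T.symm ∧ ∀ x y : X, E x y ↔ E (T x) (T y)}
  one_mem' := ⟨measurable_id, measurable_id, fun _ _ => Iff.rfl⟩
  mul_mem' := fun {S T} hS hT =>
    ⟨hS.1.comp hT.1, hT.2.1.comp hS.2.1, fun x y => (hT.2.2 x y).trans (hS.2.2 (T x) (T y))⟩
  inv_mem' := fun {T} hT => ⟨hT.2.1, hT.1, fun x y => by
    have h := hT.2.2 (T.symm x) (T.symm y)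
    rw [T.apply_symm_apply, T.apply_symm_apply] at h
    exact h.symm⟩

/-- A permutation `f` of `X/E` is Borel if `{(x, y) | f [x] = [y]}` is a Borel set. -/
def IsBorelPerm {X : Type*} [MeasurableSpace X] (E : Setoid X)
    (f : Equiv.Perm (Quotient E)) : Prop :=
  MeasurableSet {p : X × X | f (Quotient.mk E p.1) = Quotient.mk E p.2}

/-- A permutation of `X/E` is outer if it is induced by a Borel automorphism of `E`. -/
def IsOuterPerm {X : Type*} [MeasurableSpace X] (E : Setoid X)
    (f : Equiv.Perm (Quotient E)) : Prop :=
  ∃ T : autB E, ∀ x : X, f (Quotient.mk E x) = Quotient.mk E ((T : Equiv.Perm X) x)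

/-- An action of `G` on `X/E` is Borel if every element of `G` acts by a Borel permutation. -/
def IsBorelAction {X : Type*} [MeasurableSpace X] (E : Setoid X) {G : Type*} [Group G]
    (a : G →* Equiv.Perm (Quotient E)) : Prop :=
  ∀ g : G, IsBorelPerm E (a g)

/-- An action of `G` on `X/E` is outer if every element of `G` acts by an outer permutation. -/
def IsOuterAction {X : Type*} [MeasurableSpace X] (E : Setoid X) {G : Type*} [Group G]
    (a : G →* Equiv.Perm (Quotient E)) : Prop :=
  ∀ g : G, IsOuterPerm E (a g)

/-- The action `b` of `G` on `X` by Borel automorphisms of `E` is a lift of the action `a` of `G`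
on `X/E`. -/
def IsLift {X : Type*} [MeasurableSpace X] (E : Setoid X) {G : Type*} [Group G]
    (a : G →* Equiv.Perm (Quotient E)) (b : G →* autB E) : Prop :=
  ∀ (g : G) (x : X), a g (Quotient.mk E x) = Quotient.mk E ((b g : Equiv.Perm X) x)

/-- The quotient map `X → X/E` is injective on every orbit of the action `b`. -/
def IsClassBijective {X : Type*} [MeasurableSpace X] (E : Setoid X) {G : Type*} [Group G]
    (b : G →* autB E) : Prop :=
  ∀ (g : G) (x : X), E ((b g : Equiv.Perm X) x) x → (b g : Equiv.Perm X) x = x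

end CBER

section

open Set MeasureTheory Filter Topology

namespace CBER

/-! The implications (1) → (2) → (3) → (4) are formal; the content lies in (5) → (1), in (4) → (5),
and in the absorption of `E × I_ℕ` by hyperfinite relations.

(5) → (1): a pair `(x, g)` names the class `g·[x]`. Let `Z` consist of `x` together with a class in
the orbit of `[x]`. The group acts on `Z` by moving the class and keeping `x`, so whatever fixes the
class fixes the point: on `Z` the lift exists and is class-bijective. Since a compressible `E`
absorbs `I_ℕ`, Borel injections over `X/E` go both ways between `X` and `Z`, and Schröder–Bernstein
(`exists_measurableEquiv_over`) transports the action to `X`.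

(4) → (5): if `E` absorbs countably many copies of `E × I_ℕ`, it is isomorphic to one sheet `E` plus
one sheet `E × I_ℕ` for each `g ≠ 1`. Then `X/E` is `X/E × G`, on which `G` acts by translation. An
automorphism inducing some `g ≠ 1` matches the sheet `E` with a sheet `E × I_ℕ`, class by class, and
this is a compression.

Absorption: iterating `E ≅ E ⊕ (E × I_ℕ)` gives it directly. For hyperfinite `E`, the Glimm–Effros
dichotomy leaves two cases. If `E` is not smooth, equality modulo finite sets embeds in `E`, and
every hyperfinite relation reduces to equality modulo finite sets; the `I_ℕ` coordinate is hidden in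
a finite modification. If `E` is smooth with infinitely many classes, the space `S` of classes is an
infinite standard Borel space and `S × ℕ ≅ S`. Finitely many infinite classes are compressible
outright.

The descriptive set theory underneath consists of Lusin–Novikov (`exists_label`) and Feldman–Moore
(`IsCBER.exists_isGen`). -/

/-! ### Countable-to-one Borel maps: Lusin–Novikov. -/

/-- A set is `IsSmall f` if it is covered by countably many Borel sets on which `f` is injective. -/
def IsSmall {C X : Type*} [MeasurableSpace C] (f : C → X) (S : Set C) : Prop :=
  ∃ D : ℕ → Set C, (∀ n, MeasurableSet (D n)) ∧ (∀ n, InjOn f (D n)) ∧ S ⊆ ⋃ n, D n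

theorem isSmall_iUnion {C X ι : Type*} [MeasurableSpace C] [Countable ι] {f : C → X}
    {S : ι → Set C} (hS : ∀ i, IsSmall f (S i)) : IsSmall f (⋃ i, S i) := by
  rcases isEmpty_or_nonempty ι with h | h
  · exact ⟨fun _ => ∅, fun _ => .empty, fun _ => injOn_empty _, by simp⟩
  choose D hD hI hsub using hS
  obtain ⟨e, he⟩ := exists_surjective_nat (ι × ℕ)
  refine ⟨fun n => D (e n).1 (e n).2, fun n => hD _ _, fun n => hI _ _, ?_⟩
  refine iUnion_subset fun i x hx => ?_
  obtain ⟨n, hn⟩ := mem_iUnion.1 (hsub i hx)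
  obtain ⟨m, hm⟩ := he (i, n)
  exact mem_iUnion.2 ⟨m, by rw [hm]; exact hn⟩

theorem isSmall_of_injOn {C X : Type*} [MeasurableSpace C] {f : C → X}
    {S : Set C} (hS : MeasurableSet S) (hI : InjOn f S) : IsSmall f S :=
  ⟨fun _ => S, fun _ => hS, fun _ => hI, fun _ hx => mem_iUnion.2 ⟨0, hx⟩⟩

/-- Finitely many analytic sets with empty intersection can be enlarged to Borel sets with
empty intersection. -/
theorem exists_measurableSet_superset_iInter_eq_empty {X : Type*} [TopologicalSpace X]
    [PolishSpace X] [MeasurableSpace X] [BorelSpace X] {n : ℕ} (A : Fin n → Set X)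
    (hA : ∀ i, AnalyticSet (A i)) (h : ⋂ i, A i = ∅) :
    ∃ D : Fin n → Set X, (∀ i, MeasurableSet (D i)) ∧ (∀ i, A i ⊆ D i) ∧ ⋂ i, D i = ∅ := by
  suffices H : ∀ (n : ℕ) (A : Fin n → Set X) (B : Set X), (∀ i, AnalyticSet (A i)) →
      MeasurableSet B → B ∩ ⋂ i, A i = ∅ →
      ∃ D : Fin n → Set X, (∀ i, MeasurableSet (D i)) ∧ (∀ i, A i ⊆ D i) ∧ B ∩ ⋂ i, D i = ∅ by
    obtain ⟨D, h1, h2, h3⟩ := H n A univ hA .univ (by simpa using h)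
    exact ⟨D, h1, h2, by simpa using h3⟩
  clear h hA A n
  intro n
  induction n with
  | zero => intro A B _ _ h; exact ⟨A, fun i => i.elim0, fun i => i.elim0, h⟩
  | succ n ih =>
    intro A B hA hB h
    have key : ∀ A : Fin (n + 1) → Set X, ⋂ i, A i = A 0 ∩ ⋂ i : Fin n, A i.succ := by
      intro A; ext x; simp [Fin.forall_fin_succ]
    have hT : AnalyticSet (B ∩ ⋂ i : Fin n, A i.succ) := by
      rcases isEmpty_or_nonempty (Fin n) with h' | h'
      · simpa using hB.analyticSet
      · have : B ∩ ⋂ i : Fin n, A i.succ = ⋂ b : Bool, cond b B (⋂ i : Fin n, A i.succ) := by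
          ext x; simp [Bool.forall_bool, and_comm]
        rw [this]
        refine AnalyticSet.iInter fun b => ?_
        cases b
        · exact AnalyticSet.iInter fun i => hA _
        · exact hB.analyticSet
    have hdisj : Disjoint (A 0) (B ∩ ⋂ i : Fin n, A i.succ) := by
      rw [disjoint_iff_inter_eq_empty, ← h, key, inter_left_comm]
    obtain ⟨D0, hAD, hD, hDm⟩ := (hA 0).measurablySeparable hT hdisj
    obtain ⟨D, h1, h2, h3⟩ := ih (fun i => A i.succ) (B ∩ D0) (fun i => hA _) (hB.inter hDm) (by
      rw [inter_right_comm, inter_comm]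
      exact disjoint_iff_inter_eq_empty.1 hD.symm)
    refine ⟨Fin.cons D0 D, ?_, ?_, ?_⟩
    · exact Fin.cases hDm h1
    · exact Fin.cases hAD h2
    · rw [key]; simpa [inter_assoc] using h3

theorem exists_measurableSet_superset_iInter_eq_empty' {X ι : Type*} [Finite ι]
    [TopologicalSpace X] [PolishSpace X] [MeasurableSpace X] [BorelSpace X] (A : ι → Set X)
    (hA : ∀ i, AnalyticSet (A i)) (h : ⋂ i, A i = ∅) :
    ∃ D : ι → Set X, (∀ i, MeasurableSet (D i)) ∧ (∀ i, A i ⊆ D i) ∧ ⋂ i, D i = ∅ := by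
  obtain ⟨n, ⟨e⟩⟩ := Finite.exists_equiv_fin ι
  obtain ⟨D, h1, h2, h3⟩ := exists_measurableSet_superset_iInter_eq_empty (fun i => A (e.symm i))
    (fun i => hA _) (by rw [← h]; exact e.symm.surjective.iInter_comp A)
  refine ⟨fun i => D (e i), fun i => h1 _, fun i => ?_, ?_⟩
  · simpa using h2 (e i)
  · rw [← h3]; exact e.surjective.iInter_comp D

/-- A finite family of sets is negligible for `f` if, after removing a small Borel set, their images
have empty intersection. -/
def IsNegl {C X ι : Type*} [MeasurableSpace C] (f : C → X) (U : ι → Set C) : Prop :=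
  ∃ S : Set C, MeasurableSet S ∧ IsSmall f S ∧ ¬ ∃ x, ∀ i, ∃ c ∈ U i \ S, f c = x

/-- The successor step of a Cantor scheme whose sets at each level keep a common image point. If
every splitting by basic open sets were negligible, remove the countable union `T` of the small sets
witnessing this. Then no `x` has two distinct preimages in every `U i \ T`, since neighbourhoods
separating them would be a splitting. So the analytic sets `A i` of points with two preimages have
empty intersection and can be enlarged to such Borel sets `D i`. Off `f ⁻¹' D i` the map is
injective on `U i \ T`; removing these small sets too makes `U` negligible. -/
theorem exists_split {C X ι : Type*} [Finite ι] [MetricSpace C] [SecondCountableTopology C]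
    [CompleteSpace C] [MeasurableSpace C] [BorelSpace C] [TopologicalSpace X] [PolishSpace X]
    [MeasurableSpace X] [BorelSpace X] {f : C → X} (hf : Continuous f) {ε : ℝ} (hε : 0 < ε)
    (U : ι → Set C) (hU : ∀ i, IsOpen (U i)) (hneg : ¬ IsNegl f U) :
    ∃ V : ι → Bool → Set C, (∀ i b, IsOpen (V i b)) ∧ (∀ i b, closure (V i b) ⊆ U i) ∧
      (∀ i, Disjoint (V i false) (V i true)) ∧
      (∀ i b, ∀ c ∈ V i b, ∀ c' ∈ V i b, dist c c' ≤ ε) ∧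
      ¬ IsNegl f (fun p : ι × Bool => V p.1 p.2) := by
  classical
  by_contra! hcon
  apply hneg
  let B := TopologicalSpace.countableBasis C
  have hB := TopologicalSpace.isBasis_countableBasis C
  have hBc : Countable B := (TopologicalSpace.countable_countableBasis C).to_subtype
  let Good : Set (ι → Bool → B) := {V | (∀ i b, closure (V i b : Set C) ⊆ U i) ∧
      (∀ i, Disjoint (V i false : Set C) (V i true)) ∧
      (∀ i b, ∀ c ∈ (V i b : Set C), ∀ c' ∈ (V i b : Set C), dist c c' ≤ ε)}
  have hneg' : ∀ V : Good, IsNegl f (fun p : ι × Bool => (V.1 p.1 p.2 : Set C)) := fun V =>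
    hcon (fun i b => V.1 i b) (fun i b => hB.isOpen (V.1 i b).2) V.2.1 V.2.2.1 V.2.2.2
  choose S hSm hSs hSe using hneg'
  have hGc : Countable Good := inferInstance
  set T : Set C := ⋃ V, S V with hT
  have hTm : MeasurableSet T := MeasurableSet.iUnion hSm
  have hTs : IsSmall f T := isSmall_iUnion hSs
  let Q : ι → Set (C × C) := fun i => {p | p.1 ≠ p.2 ∧ p.1 ∈ U i \ T ∧ p.2 ∈ U i \ T ∧
    f p.1 = f p.2}
  have hfm : Measurable f := hf.measurable
  have hQm : ∀ i, MeasurableSet (Q i) := fun i => by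
    have hUm : MeasurableSet (U i \ T) := (hU i).measurableSet.diff hTm
    have h1 : MeasurableSet {p : C × C | p.1 ≠ p.2} :=
      (measurableSet_eq_fun measurable_fst measurable_snd).compl
    exact h1.inter ((measurable_fst hUm).inter ((measurable_snd hUm).inter
      (measurableSet_eq_fun (hfm.comp measurable_fst) (hfm.comp measurable_snd))))
  let A : ι → Set X := fun i => (fun p : C × C => f p.1) '' Q i
  have hA : ∀ i, AnalyticSet (A i) := fun i =>
    (hQm i).analyticSet.image_of_continuous (hf.comp continuous_fst)
  have hAe : ⋂ i, A i = ∅ := by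
    rw [eq_empty_iff_forall_notMem]
    intro x hx
    rw [mem_iInter] at hx
    choose p hp hpx using hx
    have key : ∀ i, ∃ V : Bool → B, (∀ b, closure (V b : Set C) ⊆ U i) ∧
        Disjoint (V false : Set C) (V true) ∧
        (∀ b, ∀ c ∈ (V b : Set C), ∀ c' ∈ (V b : Set C), dist c c' ≤ ε) ∧
        (p i).1 ∈ (V false : Set C) ∧ (p i).2 ∈ (V true : Set C) := by
      intro i
      obtain ⟨h1, h2, h3, -⟩ := hp i
      obtain ⟨W1, W2, hW1, hW2, hm1, hm2, hd⟩ := t2_separation h1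
      have aux : ∀ (c : C) (W : Set C), IsOpen W → c ∈ W → c ∈ U i → ∃ V : B,
          closure (V : Set C) ⊆ U i ∧ (V : Set C) ⊆ W ∧
          (∀ c ∈ (V : Set C), ∀ c' ∈ (V : Set C), dist c c' ≤ ε) ∧ c ∈ (V : Set C) := by
        intro c W hW hcW hcU
        have hn : U i ∩ (W ∩ Metric.ball c (ε / 2)) ∈ 𝓝 c :=
          inter_mem ((hU i).mem_nhds hcU) (inter_mem (hW.mem_nhds hcW)
            (Metric.ball_mem_nhds c (half_pos hε)))
        obtain ⟨V, hVB, hcV, hV⟩ := hB.exists_closure_subset hn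
        refine ⟨⟨V, hVB⟩, hV.trans inter_subset_left,
          subset_closure.trans (hV.trans (inter_subset_right.trans inter_subset_left)), ?_, hcV⟩
        intro a ha b hb
        have h1 := (hV (subset_closure ha)).2.2
        have h2 := (hV (subset_closure hb)).2.2
        rw [Metric.mem_ball] at h1 h2
        have := dist_triangle_right a b c
        linarith
      obtain ⟨V1, a1, b1, c1, d1⟩ := aux _ W1 hW1 hm1 h2.1
      obtain ⟨V2, a2, b2, c2, d2⟩ := aux _ W2 hW2 hm2 h3.1
      refine ⟨fun b => cond b V2 V1, ?_, hd.mono b1 b2, ?_, d1, d2⟩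
      · intro b; cases b <;> assumption
      · intro b; cases b <;> assumption
    choose V hV1 hV2 hV3 hV4 hV5 using key
    refine hSe ⟨V, hV1, hV2, hV3⟩ ⟨x, ?_⟩
    have hsub : S ⟨V, hV1, hV2, hV3⟩ ⊆ T := subset_iUnion S _
    rintro ⟨i, b⟩
    obtain ⟨h1, h2, h3, h4⟩ := hp i
    cases b
    · exact ⟨(p i).1, ⟨hV4 i, fun h => h2.2 (hsub h)⟩, hpx i⟩
    · exact ⟨(p i).2, ⟨hV5 i, fun h => h3.2 (hsub h)⟩, h4 ▸ hpx i⟩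
  obtain ⟨D, hDm, hAD, hDe⟩ := exists_measurableSet_superset_iInter_eq_empty' A hA hAe
  have hRm : ∀ i, MeasurableSet ((U i \ T) \ f ⁻¹' D i) := fun i =>
    ((hU i).measurableSet.diff hTm).diff (hfm (hDm i))
  refine ⟨T ∪ ⋃ i, (U i \ T) \ f ⁻¹' D i, hTm.union (.iUnion hRm), ?_, ?_⟩
  · have : T ∪ ⋃ i, (U i \ T) \ f ⁻¹' D i =
        ⋃ o : Option ι, o.elim T (fun i => (U i \ T) \ f ⁻¹' D i) := by
      rw [iUnion_option]; rfl
    rw [this]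
    have : Countable (Option ι) := inferInstance
    refine isSmall_iUnion fun o => ?_
    cases o with
    | none => exact hTs
    | some i =>
      refine isSmall_of_injOn (hRm i) fun a ha b hb hab => ?_
      by_contra hne
      exact ha.2 (hAD i ⟨(a, b), ⟨hne, ha.1, hb.1, hab⟩, rfl⟩)
  · rintro ⟨x, hx⟩
    have : x ∈ ⋂ i, D i := by
      refine mem_iInter.2 fun i => ?_
      obtain ⟨c, ⟨hcU, hcS⟩, rfl⟩ := hx i
      by_contra hD
      exact hcS (by
        by_cases hcT : c ∈ T
        · exact Or.inl hcT
        · exact Or.inr (mem_iUnion.2 ⟨i, ⟨hcU, hcT⟩, hD⟩))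
    rw [hDe] at this
    exact this


/-- If `C` were not small, repeated splitting would give a Cantor scheme in which all sets of level
`n` have a common image point `x n`. Every branch `α` converges to some `c α` with `f (c α) = lim x
n`, so one fibre would contain a copy of Cantor space. -/
theorem isSmall_univ_of_continuous {C X : Type*} [MetricSpace C] [SecondCountableTopology C]
    [CompleteSpace C] [MeasurableSpace C] [BorelSpace C] [TopologicalSpace X] [PolishSpace X]
    [MeasurableSpace X] [BorelSpace X] {f : C → X} (hf : Continuous f)
    (hc : ∀ x, (f ⁻¹' {x}).Countable) : IsSmall f univ := by
  by_contra hbig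
  let St : ℕ → Type _ := fun n =>
    {U : (Fin n → Bool) → Set C // (∀ s, IsOpen (U s)) ∧ ¬ IsNegl f U}
  have step : ∀ (n : ℕ) (U : St n), ∃ V : St (n + 1),
      (∀ s : Fin (n + 1) → Bool, closure (V.1 s) ⊆ U.1 (fun k => s k.castSucc)) ∧
      (∀ s t : Fin (n + 1) → Bool, (∀ k : Fin n, s k.castSucc = t k.castSucc) →
        s (Fin.last n) ≠ t (Fin.last n) → Disjoint (V.1 s) (V.1 t)) ∧
      (∀ s, ∀ c ∈ V.1 s, ∀ c' ∈ V.1 s, dist c c' ≤ (1 / 2) ^ n) := by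
    rintro n ⟨U, hU, hUn⟩
    obtain ⟨V, h1, h2, h3, h4, h5⟩ := exists_split hf (ε := (1 / 2) ^ n) (by positivity) U hU hUn
    refine ⟨⟨fun s => V (fun k => s k.castSucc) (s (Fin.last n)), fun s => h1 _ _, ?_⟩,
      fun s => h2 _ _, ?_, fun s => h4 _ _⟩
    · rintro ⟨S, hS, hS', hS''⟩
      refine h5 ⟨S, hS, hS', ?_⟩
      rintro ⟨x, hx⟩
      exact hS'' ⟨x, fun s => hx (_, _)⟩
    · intro s t hst hne
      have : (fun k : Fin n => s k.castSucc) = fun k => t k.castSucc := funext hst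
      simp only [this]
      cases hs : s (Fin.last n) <;> cases ht : t (Fin.last n)
      · exact absurd (hs.trans ht.symm) hne
      · exact h3 _
      · exact (h3 _).symm
      · exact absurd (hs.trans ht.symm) hne
  have init : Nonempty (St 0) := by
    refine ⟨⟨fun _ => univ, fun _ => isOpen_univ, ?_⟩⟩
    rintro ⟨S, -, ⟨D, hD, hI, hsub⟩, hS⟩
    refine hbig ⟨D, hD, hI, fun c _ => hsub ?_⟩
    by_contra hcS
    exact hS ⟨f c, fun _ => ⟨c, ⟨mem_univ _, hcS⟩, rfl⟩⟩
  choose nxt hn1 hn2 hn3 using step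
  let U : ∀ n, St n := fun n => Nat.rec init.some (fun n V => nxt n V) n
  have hU : ∀ n, U (n + 1) = nxt n (U n) := fun n => rfl
  let r : (ℕ → Bool) → ∀ n, Fin n → Bool := fun α n k => α k
  have hne : ∀ n, ∃ x, ∀ s, ∃ c ∈ (U n).1 s, f c = x := by
    intro n
    by_contra hcon
    exact (U n).2.2 ⟨∅, .empty, ⟨fun _ => ∅, fun _ => .empty, fun _ => injOn_empty _, by simp⟩,
      by simpa using hcon⟩
  choose x hx using hne
  choose p hpU hpx using hx
  have hsub : ∀ α n, closure ((U (n + 1)).1 (r α (n + 1))) ⊆ (U n).1 (r α n) := fun α n =>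
    hn1 n (U n) (r α (n + 1))
  have hanti : ∀ α, Antitone fun n => (U n).1 (r α n) := fun α =>
    antitone_nat_of_succ_le fun n => subset_closure.trans (hsub α n)
  have hcauchy : ∀ α, CauchySeq fun n => p n (r α n) := by
    intro α
    refine (cauchySeq_shift (k := 1)).1 <| cauchySeq_of_le_geometric (1 / 2) 1 (by norm_num)
      fun n => ?_
    rw [one_mul]
    exact hn3 n (U n) (r α (n + 1)) _ (hpU (n + 1) _) _
      (hanti α (Nat.le_succ (n + 1)) (hpU (n + 1 + 1) _))
  choose c hcl using fun α => cauchySeq_tendsto_of_complete (hcauchy α)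
  have hcU : ∀ α n, c α ∈ (U n).1 (r α n) := by
    intro α n
    refine hsub α n (mem_closure_of_tendsto (hcl α) ?_)
    filter_upwards [eventually_ge_atTop (n + 1)] with m hm
    exact hanti α hm (hpU _ _)
  have hfc : ∀ α, Tendsto x atTop (𝓝 (f (c α))) := fun α => by
    have := (hf.tendsto (c α)).comp (hcl α)
    refine this.congr fun n => hpx n _
  have hinj : Function.Injective c := by
    intro α β hαβ
    by_contra hne
    have hex : ∃ n, α n ≠ β n := by
      by_contra! h; exact hne (funext h)
    classical
    have h1 := Nat.find_spec hex
    have h2 : ∀ k < Nat.find hex, α k = β k := fun k hk => by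
      simpa using Nat.find_min hex hk
    refine (disjoint_left.1 (hn2 _ (U (Nat.find hex)) (r α _) (r β _) (fun k => h2 k k.2) h1)
      (hcU α (Nat.find hex + 1)) ?_)
    rw [hαβ]; exact hcU β (Nat.find hex + 1)
  have hcount : (range c).Countable := by
    refine (hc (f (c fun _ => false))).mono ?_
    rintro _ ⟨α, rfl⟩
    exact tendsto_nhds_unique (hfc α) (hfc _)
  have : Countable (ℕ → Bool) := by
    have := hcount.to_subtype
    exact (rangeFactorization_injective.2 hinj).countable
  have h1 := Cardinal.mk_le_aleph0 (α := ℕ → Bool)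
  rw [← Cardinal.power_def, Cardinal.mk_bool, Cardinal.mk_nat] at h1
  exact absurd h1 (not_le.2 (Cardinal.cantor _))

theorem isSmall_univ_of_continuous' {C X : Type*} [TopologicalSpace C] [PolishSpace C]
    [MeasurableSpace C] [BorelSpace C] [TopologicalSpace X] [PolishSpace X]
    [MeasurableSpace X] [BorelSpace X] {f : C → X} (hf : Continuous f)
    (hc : ∀ x, (f ⁻¹' {x}).Countable) : IsSmall f univ := by
  let := TopologicalSpace.upgradeIsCompletelyMetrizable C
  exact isSmall_univ_of_continuous hf hc

/-- A finer Polish topology with the same Borel sets makes `f` continuous, and smallness depends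
only on the Borel sets. -/
theorem isSmall_univ_of_measurable {C X : Type*} [t₀ : TopologicalSpace C] [p₀ : PolishSpace C]
    [MeasurableSpace C] [h₀ : BorelSpace C] [TopologicalSpace X] [PolishSpace X]
    [MeasurableSpace X] [BorelSpace X] {f : C → X} (hf : Measurable f)
    (hc : ∀ x, (f ⁻¹' {x}).Countable) : IsSmall f univ := by
  obtain ⟨t, ht, hft, htp⟩ := hf.exists_continuous
  have hb : @BorelSpace C t _ := @BorelSpace.mk C t _ (h₀.measurable_eq.trans
    (borel_eq_borel_of_le htp p₀ ht).symm)
  exact @isSmall_univ_of_continuous' C X t htp _ hb _ _ _ _ f hft hc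

/-- **Lusin–Novikov**: a countable-to-one Borel map is injective on each piece of a suitable
countable Borel cover; in terms of the labels given by such a cover. -/
theorem exists_label {C X : Type*} [MeasurableSpace C] [StandardBorelSpace C] [MeasurableSpace X]
    [StandardBorelSpace X] {f : C → X} (hf : Measurable f) (hc : ∀ x, (f ⁻¹' {x}).Countable) :
    ∃ l : C → ℕ, Measurable l ∧ Function.Injective fun c => (f c, l c) := by
  classical
  have hsm : IsSmall f univ := by
    let := upgradeStandardBorel C
    let := upgradeStandardBorel X
    exact isSmall_univ_of_measurable hf hc
  obtain ⟨D, hD, hI, hsub⟩ := hsm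
  have hex : ∀ c, ∃ n, c ∈ D n := fun c => mem_iUnion.1 (hsub (mem_univ c))
  refine ⟨fun c => Nat.find (hex c), measurable_find hex hD, fun a b hab => ?_⟩
  simp only [Prod.mk.injEq] at hab
  have h1 := Nat.find_spec (hex a)
  rw [hab.2] at h1
  exact hI _ h1 (Nat.find_spec (hex b)) hab.1

theorem measurableSet_range_of_countable_fibre {C X : Type*} [MeasurableSpace C]
    [StandardBorelSpace C] [MeasurableSpace X] [StandardBorelSpace X] {f : C → X}
    (hf : Measurable f) (hc : ∀ x, (f ⁻¹' {x}).Countable) : MeasurableSet (range f) := by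
  obtain ⟨l, hl, hinj⟩ := exists_label hf hc
  have : range f = ⋃ n, f '' (l ⁻¹' {n}) := by
    ext x; simp
  rw [this]
  refine .iUnion fun n => (hl (measurableSet_singleton n)).image_of_measurable_injOn hf ?_
  intro a ha b hb hab
  exact hinj (Prod.ext hab (ha.trans hb.symm))

/-- A countable-to-one Borel map has a Borel section. -/
theorem exists_section {C X : Type*} [MeasurableSpace C] [StandardBorelSpace C] [MeasurableSpace X]
    [StandardBorelSpace X] {f : C → X} (hf : Measurable f) (hc : ∀ x, (f ⁻¹' {x}).Countable)
    [Nonempty C] : ∃ t : X → C, Measurable t ∧ ∀ c, f (t (f c)) = f c := by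
  classical
  obtain ⟨l, hl, hinj⟩ := exists_label hf hc
  have hl' : ∀ x : X, x ∈ range f → ∃ n, x ∈ f '' (l ⁻¹' {n}) := by
    rintro _ ⟨c, rfl⟩; exact ⟨l c, c, rfl, rfl⟩
  have him : ∀ n (B : Set C), MeasurableSet B → MeasurableSet (f '' (l ⁻¹' {n} ∩ B)) := by
    intro n B hB
    refine ((hl (measurableSet_singleton n)).inter hB).image_of_measurable_injOn hf ?_
    intro a ha b hb hab
    exact hinj (Prod.ext hab (ha.1.trans hb.1.symm))
  have him' : ∀ n, MeasurableSet (f '' (l ⁻¹' {n})) := fun n => by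
    simpa using him n univ .univ
  have hrange := measurableSet_range_of_countable_fibre hf hc
  have hex : ∀ x : X, ∃ n, x ∉ range f ∨ x ∈ f '' (l ⁻¹' {n}) := fun x => by
    by_cases hx : x ∈ range f
    · obtain ⟨n, hn⟩ := hl' x hx; exact ⟨n, Or.inr hn⟩
    · exact ⟨0, Or.inl hx⟩
  -- The section takes the point of least label in the fibre; `N` is `0` off the range.
  let N : X → ℕ := fun x => Nat.find (hex x)
  have hN : Measurable N := measurable_find hex fun n => hrange.compl.union (him' n)
  have hspec : ∀ x : X, x ∈ range f → ∃ c, l c = N x ∧ f c = x := fun x hx => by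
    have := (Nat.find_spec (hex x)).resolve_left (fun h => h hx)
    exact this
  let t : X → C := fun x => if h : x ∈ range f then (hspec x h).choose else Classical.arbitrary C
  have ht : ∀ x, ∀ h : x ∈ range f, l (t x) = N x ∧ f (t x) = x := fun x h => by
    simp only [t, dif_pos h]; exact (hspec x h).choose_spec
  refine ⟨t, fun B hB => ?_, fun c => (ht _ (mem_range_self c)).2⟩
  have : t ⁻¹' B = (⋃ n, N ⁻¹' {n} ∩ f '' (l ⁻¹' {n} ∩ B)) ∪
      ((range f)ᶜ ∩ {_x | Classical.arbitrary C ∈ B}) := by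
    ext x
    by_cases hx : x ∈ range f
    · obtain ⟨h1, h2⟩ := ht x hx
      simp only [mem_preimage, mem_union, mem_iUnion, mem_inter_iff, mem_singleton_iff, mem_image,
        mem_compl_iff, hx, not_true_eq_false, false_and, or_false]
      constructor
      · intro h; exact ⟨N x, rfl, t x, ⟨h1, h⟩, h2⟩
      · rintro ⟨n, rfl, c, ⟨hc1, hc2⟩, hc3⟩
        have : c = t x := hinj (Prod.ext (hc3.trans h2.symm) (hc1.trans h1.symm))
        rwa [← this]
    · have h1 : t x = Classical.arbitrary C := by simp only [t, dif_neg hx]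
      have h2 : ∀ n, x ∉ f '' (l ⁻¹' {n} ∩ B) := by
        rintro n ⟨c, -, rfl⟩; exact hx ⟨c, rfl⟩
      simp [h1, h2, hx]
  rw [this]
  refine .union (.iUnion fun n => (hN (measurableSet_singleton n)).inter (him n B hB))
    (hrange.compl.inter (.const _))


/-! ### Feldman–Moore involutions, complete sections and Schröder–Bernstein. -/

/-- `E` is the orbit equivalence relation of a sequence of Borel involutions. -/
structure IsGen {X : Type*} [MeasurableSpace X] (E : Setoid X) (γ : ℕ → X → X) : Prop where
  measurable : ∀ i, Measurable (γ i)
  invol : ∀ i x, γ i (γ i x) = x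
  rel : ∀ x y, E x y ↔ ∃ i, γ i x = y

/-- A Borel partial injection with disjoint domain and range extends to a Borel involution. -/
theorem exists_involution {X : Type*} [MeasurableSpace X] [StandardBorelSpace X]
    {C : Set (X × X)} (hC : MeasurableSet C) (h1 : InjOn Prod.fst C) (h2 : InjOn Prod.snd C)
    (h12 : Disjoint (Prod.fst '' C) (Prod.snd '' C)) :
    ∃ g : X → X, Measurable g ∧ (∀ x, g (g x) = x) ∧ (∀ x y, (x, y) ∈ C → g x = y) ∧
      ∀ x, g x = x ∨ (x, g x) ∈ C ∨ (g x, x) ∈ C := by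
  classical
  let g : X → X := fun x => if h : ∃ y, (x, y) ∈ C then h.choose else
    if h : ∃ y, (y, x) ∈ C then h.choose else x
  have g1 : ∀ x y, (x, y) ∈ C → g x = y := by
    intro x y hxy
    have h : ∃ y, (x, y) ∈ C := ⟨y, hxy⟩
    simp only [g, dif_pos h]
    exact congrArg Prod.snd (h1 h.choose_spec hxy rfl)
  have g2 : ∀ x y, (x, y) ∈ C → g y = x := by
    intro x y hxy
    have hn : ¬ ∃ z, (y, z) ∈ C := by
      rintro ⟨z, hz⟩
      exact disjoint_left.1 h12 ⟨_, hz, rfl⟩ ⟨_, hxy, rfl⟩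
    have h : ∃ z, (z, y) ∈ C := ⟨x, hxy⟩
    simp only [g, dif_neg hn, dif_pos h]
    exact congrArg Prod.fst (h2 h.choose_spec hxy rfl)
  have g3 : ∀ x, x ∉ Prod.fst '' C → x ∉ Prod.snd '' C → g x = x := by
    intro x hx1 hx2
    have hn1 : ¬ ∃ z, (x, z) ∈ C := fun ⟨z, hz⟩ => hx1 ⟨_, hz, rfl⟩
    have hn2 : ¬ ∃ z, (z, x) ∈ C := fun ⟨z, hz⟩ => hx2 ⟨_, hz, rfl⟩
    simp only [g, dif_neg hn1, dif_neg hn2]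
  have him1 : ∀ M : Set X, MeasurableSet M → MeasurableSet (Prod.fst '' (C ∩ Prod.snd ⁻¹' M)) :=
    fun M hM => (hC.inter (measurable_snd hM)).image_of_measurable_injOn measurable_fst
      (h1.mono inter_subset_left)
  have him2 : ∀ M : Set X, MeasurableSet M → MeasurableSet (Prod.snd '' (C ∩ Prod.fst ⁻¹' M)) :=
    fun M hM => (hC.inter (measurable_fst hM)).image_of_measurable_injOn measurable_snd
      (h2.mono inter_subset_left)
  have hd1 : MeasurableSet (Prod.fst '' C) := by simpa using him1 univ .univ
  have hd2 : MeasurableSet (Prod.snd '' C) := by simpa using him2 univ .univ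
  refine ⟨g, fun M hM => ?_, fun x => ?_, g1, fun x => ?_⟩
  · have : g ⁻¹' M = Prod.fst '' (C ∩ Prod.snd ⁻¹' M) ∪ Prod.snd '' (C ∩ Prod.fst ⁻¹' M) ∪
        ((Prod.fst '' C ∪ Prod.snd '' C)ᶜ ∩ M) := by
      ext x
      constructor
      · intro hx
        by_cases hx1 : x ∈ Prod.fst '' C
        · obtain ⟨⟨a, b⟩, hab, rfl⟩ := hx1
          refine Or.inl (Or.inl ⟨(a, b), ⟨hab, ?_⟩, rfl⟩)
          rw [mem_preimage, g1 a b hab] at hx; exact hx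
        by_cases hx2 : x ∈ Prod.snd '' C
        · obtain ⟨⟨a, b⟩, hab, rfl⟩ := hx2
          refine Or.inl (Or.inr ⟨(a, b), ⟨hab, ?_⟩, rfl⟩)
          rw [mem_preimage, g2 a b hab] at hx; exact hx
        · rw [mem_preimage, g3 x hx1 hx2] at hx
          exact Or.inr ⟨by rintro (h | h) <;> contradiction, hx⟩
      · rintro ((⟨⟨a, b⟩, ⟨hab, hM⟩, rfl⟩ | ⟨⟨a, b⟩, ⟨hab, hM⟩, rfl⟩) | ⟨hx, hM⟩)
        · rw [mem_preimage, g1 a b hab]; exact hM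
        · rw [mem_preimage, g2 a b hab]; exact hM
        · rw [mem_preimage, g3 x (fun h => hx (Or.inl h)) (fun h => hx (Or.inr h))]; exact hM
    rw [this]
    exact ((him1 M hM).union (him2 M hM)).union ((hd1.union hd2).compl.inter hM)
  · by_cases hx1 : x ∈ Prod.fst '' C
    · obtain ⟨⟨a, b⟩, hab, rfl⟩ := hx1
      rw [g1 a b hab, g2 a b hab]
    by_cases hx2 : x ∈ Prod.snd '' C
    · obtain ⟨⟨a, b⟩, hab, rfl⟩ := hx2
      rw [g2 a b hab, g1 a b hab]
    · rw [g3 x hx1 hx2, g3 x hx1 hx2]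
  · by_cases hx1 : x ∈ Prod.fst '' C
    · obtain ⟨⟨a, b⟩, hab, rfl⟩ := hx1
      right; left; rw [g1 a b hab]; exact hab
    by_cases hx2 : x ∈ Prod.snd '' C
    · obtain ⟨⟨a, b⟩, hab, rfl⟩ := hx2
      right; right; rw [g2 a b hab]; exact hab
    · left; exact g3 x hx1 hx2

/-- **Feldman–Moore**. -/
theorem IsCBER.exists_isGen {X : Type*} [MeasurableSpace X] [StandardBorelSpace X]
    {E : Setoid X} (hE : IsCBER E) : ∃ γ : ℕ → X → X, IsGen E γ := by
  obtain ⟨e, he, hei⟩ := MeasurableSpace.measurable_injection_nat_bool_of_countablySeparated X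
  let R : Set (X × X) := {p | E p.1 p.2}
  have hR : MeasurableSet R := hE.measurableSet_graph
  have := hR.standardBorel
  have hc1 : ∀ x, ((fun p : R => p.1.1) ⁻¹' {x}).Countable := by
    intro x
    refine MapsTo.countable_of_injOn (f := fun p : R => p.1.2) (t := {y | E x y}) ?_ ?_
      (hE.countable_class x)
    · rintro ⟨⟨a, b⟩, hab⟩ h
      obtain rfl : a = x := h
      exact hab
    · rintro ⟨⟨a, b⟩, hab⟩ h ⟨⟨a', b'⟩, hab'⟩ h' hh
      obtain rfl : a = x := h
      obtain rfl : a' = a := h'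
      obtain rfl : b = b' := hh
      rfl
  have hc2 : ∀ x, ((fun p : R => p.1.2) ⁻¹' {x}).Countable := by
    intro x
    refine MapsTo.countable_of_injOn (f := fun p : R => p.1.1) (t := {y | E x y}) ?_ ?_
      (hE.countable_class x)
    · rintro ⟨⟨a, b⟩, hab⟩ h
      obtain rfl : b = x := h
      exact E.symm hab
    · rintro ⟨⟨a, b⟩, hab⟩ h ⟨⟨a', b'⟩, hab'⟩ h' hh
      obtain rfl : b = x := h
      obtain rfl : b' = b := h'
      obtain rfl : a = a' := hh
      rfl
  obtain ⟨l1, hl1, hi1⟩ := exists_label (measurable_fst.comp measurable_subtype_coe) hc1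
  obtain ⟨l2, hl2, hi2⟩ := exists_label (measurable_snd.comp measurable_subtype_coe) hc2
  -- The two labels make both projections injective on a piece. Opposite bits at one position make
  -- its domain and range disjoint, so that swapping the coordinates is a well-defined involution.
  let D : ℕ × ℕ × ℕ × Bool → Set R := fun q =>
    {p | l1 p = q.1 ∧ l2 p = q.2.1 ∧ e p.1.1 q.2.2.1 = q.2.2.2 ∧ e p.1.2 q.2.2.1 = !q.2.2.2}
  let C : ℕ × ℕ × ℕ × Bool → Set (X × X) := fun q => Subtype.val '' D q
  have hea : ∀ n, Measurable fun x => e x n := fun n => (measurable_pi_apply n).comp he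
  have hD : ∀ q, MeasurableSet (D q) := by
    rintro ⟨a, b, n, c⟩
    refine (hl1 (measurableSet_singleton a)).inter ((hl2 (measurableSet_singleton b)).inter
      (MeasurableSet.inter ?_ ?_))
    · exact ((hea n).comp (measurable_fst.comp measurable_subtype_coe)) (measurableSet_singleton c)
    · exact ((hea n).comp (measurable_snd.comp measurable_subtype_coe)) (measurableSet_singleton !c)
  have hC : ∀ q, MeasurableSet (C q) := fun q => hR.subtype_image (hD q)
  have hCR : ∀ q p, p ∈ C q → E p.1 p.2 := by
    rintro q _ ⟨p, -, rfl⟩; exact p.2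
  have key : ∀ q, ∃ g : X → X, Measurable g ∧ (∀ x, g (g x) = x) ∧
      (∀ x y, (x, y) ∈ C q → g x = y) ∧ ∀ x, g x = x ∨ (x, g x) ∈ C q ∨ (g x, x) ∈ C q := by
    intro q
    refine exists_involution (hC q) ?_ ?_ ?_
    · rintro _ ⟨p, hp, rfl⟩ _ ⟨p', hp', rfl⟩ h
      exact congrArg _ (hi1 (Prod.ext h (hp.1.trans hp'.1.symm)))
    · rintro _ ⟨p, hp, rfl⟩ _ ⟨p', hp', rfl⟩ h
      exact congrArg _ (hi2 (Prod.ext h (hp.2.1.trans hp'.2.1.symm)))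
    · rw [disjoint_left]
      rintro _ ⟨_, ⟨p, hp, rfl⟩, rfl⟩ ⟨_, ⟨p', hp', rfl⟩, h⟩
      have h1 := hp.2.2.1
      have h2 := hp'.2.2.2
      rw [h, h1] at h2
      simp at h2
  choose g hgm hgi hgC hgx using key
  -- The index `none` stands for the identity, which covers the diagonal.
  obtain ⟨s, hs⟩ := exists_surjective_nat (Option (ℕ × ℕ × ℕ × Bool))
  refine ⟨fun i => (s i).elim id g, ⟨fun i => ?_, fun i x => ?_, fun x y => ⟨fun hxy => ?_, ?_⟩⟩⟩
  · rcases s i with _ | q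
    exacts [measurable_id, hgm q]
  · rcases s i with _ | q
    exacts [rfl, hgi q x]
  · by_cases hne : x = y
    · obtain ⟨i, hi⟩ := hs none
      exact ⟨i, by rw [hi]; exact hne⟩
    · have : ∃ n, e x n ≠ e y n := by
        by_contra! h; exact hne (hei (funext h))
      obtain ⟨n, hn⟩ := this
      let p : R := ⟨(x, y), hxy⟩
      obtain ⟨i, hi⟩ := hs (some (l1 p, l2 p, n, e x n))
      refine ⟨i, ?_⟩
      rw [hi]
      refine hgC _ x y ⟨p, ⟨rfl, rfl, rfl, ?_⟩, rfl⟩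
      change e y n = !(e x n)
      cases h1 : e x n <;> cases h2 : e y n <;> simp_all
  · rintro ⟨i, rfl⟩
    rcases s i with _ | q
    · exact E.refl _
    · rcases hgx q x with h | h | h
      · simp only [Option.elim, h]; exact E.refl _
      · exact hCR q _ h
      · exact E.symm (hCR q _ h)

theorem IsGen.rel_apply {X : Type*} [MeasurableSpace X] {E : Setoid X} {γ : ℕ → X → X}
    (hγ : IsGen E γ) (i : ℕ) (x : X) : E x (γ i x) := (hγ.rel _ _).2 ⟨i, rfl⟩

theorem IsGen.measurableSet_exists {X : Type*} [MeasurableSpace X] {E : Setoid X} {γ : ℕ → X → X}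
    (hγ : IsGen E γ) {A : Set X} (hA : MeasurableSet A) :
    MeasurableSet {x | ∃ y, E x y ∧ y ∈ A} := by
  have : {x | ∃ y, E x y ∧ y ∈ A} = ⋃ i, γ i ⁻¹' A := by
    ext x
    simp only [mem_iUnion, mem_preimage]
    constructor
    · rintro ⟨y, hxy, hy⟩
      obtain ⟨i, rfl⟩ := (hγ.rel x y).1 hxy
      exact ⟨i, hy⟩
    · rintro ⟨i, hi⟩
      exact ⟨_, hγ.rel_apply i x, hi⟩
  rw [this]
  exact .iUnion fun i => hγ.measurable i hA

theorem measurable_apply_nat {X Y Z : Type*} [MeasurableSpace X] [MeasurableSpace Y]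
    [MeasurableSpace Z] {γ : ℕ → X → Z} (hγ : ∀ i, Measurable (γ i)) {n : Y → ℕ}
    (hn : Measurable n) {f : Y → X} (hf : Measurable f) : Measurable fun y => γ (n y) (f y) := by
  have : Measurable fun p : X × ℕ => γ p.2 p.1 := measurable_from_prod_countable_left fun i => hγ i
  exact this.comp (hf.prodMk hn)

/-- A Borel complete section codes the whole space. -/
theorem IsCBER.exists_code {X : Type*} [MeasurableSpace X] [StandardBorelSpace X]
    {E : Setoid X} (hE : IsCBER E) {A : Set X} (hA : MeasurableSet A)
    (hAE : ∀ x, ∃ y ∈ A, E x y) :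
    ∃ (s : X → X) (c : X → ℕ), Measurable s ∧ Measurable c ∧ (∀ x, s x ∈ A) ∧ (∀ x, E x (s x)) ∧
      Function.Injective fun x => (s x, c x) := by
  classical
  obtain ⟨γ, hγ⟩ := hE.exists_isGen
  have hex : ∀ x, ∃ i, γ i x ∈ A := fun x => by
    obtain ⟨y, hy, hxy⟩ := hAE x
    obtain ⟨i, rfl⟩ := (hγ.rel x y).1 hxy
    exact ⟨i, hy⟩
  have hc : Measurable fun x => Nat.find (hex x) :=
    measurable_find hex fun i => hγ.measurable i hA
  refine ⟨fun x => γ (Nat.find (hex x)) x, fun x => Nat.find (hex x),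
    measurable_apply_nat hγ.measurable hc measurable_id, hc, fun x => Nat.find_spec (hex x),
    fun x => hγ.rel_apply _ _, fun x y hxy => ?_⟩
  simp only [Prod.mk.injEq] at hxy
  -- The involution that carried `x` into `A` carries it back, so its index and `s x` determine `x`.
  have := hγ.invol (Nat.find (hex x)) x
  rw [hxy.1, hxy.2, hγ.invol] at this
  exact this.symm

/-- Schröder–Bernstein for Borel injections over a common quotient. -/
theorem exists_measurableEquiv_over {Y Z Q : Type*} [MeasurableSpace Y] [StandardBorelSpace Y]
    [MeasurableSpace Z] [StandardBorelSpace Z] {qZ : Z → Q} {qY : Y → Q} {i : Z → Y} {j : Y → Z}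
    (hi : Measurable i) (hj : Measurable j) (hii : Function.Injective i)
    (hji : Function.Injective j) (hqi : ∀ z, qY (i z) = qZ z) (hqj : ∀ y, qZ (j y) = qY y) :
    ∃ Φ : Z ≃ᵐ Y, ∀ z, qY (Φ z) = qZ z := by
  classical
  -- The bijection is `i` on the forward orbit `B` of `(range j)ᶜ` under `j ∘ i`, and the inverse of
  -- `j` elsewhere.
  let A : ℕ → Set Z := fun n => Nat.rec (range j)ᶜ (fun _ S => (j ∘ i) '' S) n
  have hAm : ∀ n, MeasurableSet (A n) := by
    intro n
    induction n with
    | zero => exact (hj.measurableEmbedding hji).measurableSet_range.compl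
    | succ n ih =>
      exact ((hj.comp hi).measurableEmbedding (hji.comp hii)).measurableSet_image' ih
  let B : Set Z := ⋃ n, A n
  have hB : MeasurableSet B := .iUnion hAm
  have hBr : ∀ z, z ∉ B → z ∈ range j := fun z hz => by
    by_contra h; exact hz (mem_iUnion.2 ⟨0, h⟩)
  have hiB : ∀ z ∈ B, j (i z) ∈ B := fun z hz => by
    obtain ⟨n, hn⟩ := mem_iUnion.1 hz
    exact mem_iUnion.2 ⟨n + 1, z, hn, rfl⟩
  have hBi : ∀ y, j y ∈ B → ∃ z ∈ B, i z = y := fun y hy => by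
    obtain ⟨n, hn⟩ := mem_iUnion.1 hy
    cases n with
    | zero => exact absurd (mem_range_self y) hn
    | succ n =>
      obtain ⟨z, hz, hzy⟩ := hn
      exact ⟨z, mem_iUnion.2 ⟨n, hz⟩, hji hzy⟩
  let f : Z → Y := fun z => if h : z ∈ B then i z else (hBr z h).choose
  have f1 : ∀ z ∈ B, f z = i z := fun z hz => dif_pos hz
  have f2 : ∀ z, z ∉ B → j (f z) = z := fun z hz => by
    simp only [f, dif_neg hz]; exact (hBr z hz).choose_spec
  have hfi : Function.Injective f := by
    intro a b hab
    by_cases ha : a ∈ B <;> by_cases hb : b ∈ B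
    · rw [f1 a ha, f1 b hb] at hab; exact hii hab
    · exact absurd (by rw [← f2 b hb, ← hab, f1 a ha]; exact hiB a ha) hb
    · exact absurd (by rw [← f2 a ha, hab, f1 b hb]; exact hiB b hb) ha
    · rw [← f2 a ha, ← f2 b hb, hab]
  have hfs : Function.Surjective f := by
    intro y
    by_cases hy : j y ∈ B
    · obtain ⟨z, hz, rfl⟩ := hBi y hy
      exact ⟨z, f1 z hz⟩
    · exact ⟨j y, hji (f2 _ hy)⟩
  have hfm : Measurable f := by
    intro M hM
    have : f ⁻¹' M = (B ∩ i ⁻¹' M) ∪ (Bᶜ ∩ j '' M) := by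
      ext z
      by_cases hz : z ∈ B
      · simp [hz, f1 z hz]
      · simp only [mem_preimage, mem_union, mem_inter_iff, hz, false_and, mem_compl_iff,
          not_false_eq_true, true_and, false_or]
        constructor
        · intro h; exact ⟨_, h, f2 z hz⟩
        · rintro ⟨y, hy, hyz⟩
          rwa [hji ((f2 z hz).trans hyz.symm)]
    rw [this]
    exact (hB.inter (hi hM)).union (hB.compl.inter
      ((hj.measurableEmbedding hji).measurableSet_image' hM))
  have hfe := hfm.measurableEmbedding hfi
  refine ⟨⟨Equiv.ofBijective f ⟨hfi, hfs⟩, hfm, fun M hM => ?_⟩, fun z => ?_⟩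
  · rw [← Equiv.image_eq_preimage_symm]; exact hfe.measurableSet_image' hM
  · change qY (f z) = qZ z
    by_cases hz : z ∈ B
    · rw [f1 z hz, hqi]
    · rw [← hqj, f2 z hz]

/-- A compressible relation absorbs `I_ℕ`. -/
theorem IsCompressible.exists_prod_nat {X : Type*} [MeasurableSpace X] [StandardBorelSpace X]
    {E : Setoid X} (hE : IsCBER E) (hc : IsCompressible E) :
    ∃ κ : X × ℕ → X, Measurable κ ∧ Function.Injective κ ∧ ∀ p, E p.1 (κ p) := by
  obtain ⟨T, hT, hTi, hTc⟩ := hc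
  have hTE : ∀ x, E x (T x) := fun x => (hTc x).1 ⟨x, E.refl x, rfl⟩
  -- The complement of `range T` meets every class, and its images under the iterates of `T` are
  -- pairwise disjoint. The number of iterations can therefore carry both the code of `x` and the
  -- extra natural number.
  obtain ⟨s, c, hs, hcm, hsA, hsE, hsc⟩ := hE.exists_code (A := (range T)ᶜ)
    (hT.measurableEmbedding hTi).measurableSet_range.compl (fun x => by
      obtain ⟨y, hy, hyn⟩ := exists_of_ssubset (hTc x)
      refine ⟨y, ?_, hy⟩
      rintro ⟨z, rfl⟩
      exact hyn ⟨z, E.trans hy (E.symm (hTE z)), rfl⟩)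
  have hTn : ∀ n x, E x (T^[n] x) := by
    intro n
    induction n with
    | zero => exact fun x => E.refl x
    | succ n ih =>
      intro x
      rw [Function.iterate_succ_apply']
      exact E.trans (ih x) (hTE _)
  have hinj : ∀ m n x y, x ∉ range T → y ∉ range T → T^[m] x = T^[n] y → m = n ∧ x = y := by
    intro m
    induction m with
    | zero =>
      intro n x y hx hy h
      cases n with
      | zero => exact ⟨rfl, h⟩
      | succ n =>
        rw [Function.iterate_succ_apply'] at h
        exact absurd ⟨_, h.symm⟩ hx
    | succ m ih =>
      intro n x y hx hy h
      cases n with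
      | zero =>
        rw [Function.iterate_succ_apply'] at h
        exact absurd ⟨_, h⟩ hy
      | succ n =>
        rw [Function.iterate_succ_apply', Function.iterate_succ_apply'] at h
        obtain ⟨rfl, h2⟩ := ih n x y hx hy (hTi h)
        exact ⟨rfl, h2⟩
  refine ⟨fun p => T^[Nat.pair (c p.1) p.2] (s p.1), ?_, ?_, fun p => E.trans (hsE _) (hTn _ _)⟩
  · refine measurable_apply_nat (γ := fun n => T^[n]) (fun n => hT.iterate n) ?_
      (hs.comp measurable_fst)
    have : Measurable fun q : ℕ × ℕ => Nat.pair q.1 q.2 := measurable_of_countable _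
    exact this.comp ((hcm.comp measurable_fst).prodMk measurable_snd)
  · rintro ⟨x, m⟩ ⟨y, n⟩ h
    obtain ⟨h1, h2⟩ := hinj _ _ _ _ (hsA x) (hsA y) h
    rw [Nat.pair_eq_pair] at h1
    obtain rfl : x = y := hsc (Prod.ext h2 h1.1)
    exact Prod.ext rfl h1.2


/-! ### Class-bijective lifts for compressible relations. -/

section lift

variable {X : Type*} [MeasurableSpace X] {E : Setoid X} {G : Type*} [Group G]
  (a : G →* Equiv.Perm (Quotient E))

/-- The class in `X/E` named by `(x, g)`. -/
def actClass (p : X × G) : Quotient E := a p.2 (Quotient.mk E p.1)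

/-- Naming the same class is a countable union, over pairs `(g, h)`, of the Borel graphs of `h⁻¹ *
g`. It is a CBER on `X × G`, so complete sections are available there. -/
theorem isCBER_ker_actClass [Countable G] [MeasurableSpace G] [DiscreteMeasurableSpace G]
    (hE : IsCBER E) (ha : IsBorelAction E a) : IsCBER (Setoid.ker (actClass a)) := by
  constructor
  · have : {p : (X × G) × (X × G) | Setoid.ker (actClass a) p.1 p.2} =
        ⋃ q : G × G, {p | p.1.2 = q.1} ∩ ({p | p.2.2 = q.2} ∩
          (fun p => (p.1.1, p.2.1)) ⁻¹'
            {r : X × X | a (q.2⁻¹ * q.1) (Quotient.mk E r.1) = Quotient.mk E r.2}) := by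
      ext ⟨⟨x, g⟩, ⟨y, h⟩⟩
      simp only [mem_iUnion, Prod.exists]
      constructor
      · intro hp
        refine ⟨g, h, rfl, rfl, ?_⟩
        have hp' : a g (Quotient.mk E x) = a h (Quotient.mk E y) := hp
        change a (h⁻¹ * g) (Quotient.mk E x) = Quotient.mk E y
        rw [map_mul, Equiv.Perm.mul_apply, hp', ← Equiv.Perm.mul_apply, ← map_mul]
        simp
      · rintro ⟨g', h', hg, hh, hp⟩
        obtain rfl : g = g' := hg
        obtain rfl : h = h' := hh
        have hp' : a (h⁻¹ * g) (Quotient.mk E x) = Quotient.mk E y := hp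
        change a g (Quotient.mk E x) = a h (Quotient.mk E y)
        rw [← hp', ← Equiv.Perm.mul_apply, ← map_mul]
        simp
    rw [this]
    refine .iUnion fun q => .inter ?_ (.inter ?_ ?_)
    · exact (measurable_snd.comp measurable_fst) (.of_discrete (s := {q.1}))
    · exact (measurable_snd.comp measurable_snd) (.of_discrete (s := {q.2}))
    · exact ((measurable_fst.comp measurable_fst).prodMk (measurable_fst.comp measurable_snd))
        (ha _)
  · rintro ⟨x, g⟩
    have : {q : X × G | Setoid.ker (actClass a) (x, g) q} ⊆
        ⋃ h : G, (fun y => (y, h)) '' {y | E (Quotient.out (a (h⁻¹ * g) (Quotient.mk E x))) y} := by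
      rintro ⟨y, h⟩ hp
      refine mem_iUnion.2 ⟨h, y, ?_, rfl⟩
      have hp' : a g (Quotient.mk E x) = a h (Quotient.mk E y) := hp
      refine Quotient.exact (s := E) ?_
      rw [Quotient.out_eq, map_mul, Equiv.Perm.mul_apply, hp', ← Equiv.Perm.mul_apply, ← map_mul]
      simp
    exact (countable_iUnion fun h => (hE.countable_class _).image _).mono this

/-- Every Borel action on the quotient by a compressible relation has a class-bijective lift. -/
theorem IsCompressible.exists_lift [StandardBorelSpace X] [Countable G] (hE : IsCBER E)
    (hc : IsCompressible E) (ha : IsBorelAction E a) :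
    ∃ b : G →* autB E, IsLift E a b ∧ IsClassBijective E b := by
  classical
  let : MeasurableSpace G := ⊤
  have : DiscreteMeasurableSpace G := ⟨fun _ => trivial⟩
  have hker := isCBER_ker_actClass a hE ha
  have hone : ∀ x : X, actClass a (x, 1) = Quotient.mk E x := fun x => by simp [actClass]
  have hmul : ∀ (g : G) (p : X × G), actClass a (p.1, g * p.2) = a g (actClass a p) := fun g p => by
    simp [actClass]
  obtain ⟨κ, hκm, hκi, hκE⟩ := hc.exists_prod_nat hE
  obtain ⟨s, c, hsm, hcm, hsA, hsE, hsc⟩ := hker.exists_code (A := {p : X × G | p.2 = 1})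
    (measurable_snd (.of_discrete (s := {1}))) (fun p => by
      refine ⟨(Quotient.out (actClass a p), 1), rfl, ?_⟩
      change actClass a p = actClass a _
      rw [hone, Quotient.out_eq])
  obtain ⟨e, he⟩ := exists_surjective_nat G
  have hex : ∀ p : X × G, ∃ n, actClass a (p.1, e n) = actClass a p := fun p => by
    obtain ⟨n, hn⟩ := he p.2; exact ⟨n, by rw [hn]⟩
  -- The first group element giving the same class from the same `x`. The set `Z` below thus has
  -- exactly one point for each `x` and each class in the orbit of `[x]`.
  let rep : X × G → G := fun p => e (Nat.find (hex p))
  have hrep : ∀ p, actClass a (p.1, rep p) = actClass a p := fun p => Nat.find_spec (hex p)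
  have hrepeq : ∀ p q : X × G, p.1 = q.1 → actClass a p = actClass a q → rep p = rep q := by
    intro p q h1 h2
    simp only [rep]
    congr 2
    ext n; rw [h1, h2]
  have hrepm : Measurable rep := by
    have h1 : Measurable e := measurable_of_countable _
    refine h1.comp (measurable_find hex fun n => ?_)
    have hm : Measurable fun p : X × G => ((p.1, e n), p) :=
      (measurable_fst.prodMk measurable_const).prodMk measurable_id
    exact hm hker.measurableSet_graph
  let Z : Set (X × G) := {p | rep p = p.2}
  have hZ : MeasurableSet Z := measurableSet_eq_fun hrepm measurable_snd
  have := hZ.standardBorel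
  have hrr : ∀ p : X × G, (p.1, rep p) ∈ Z := fun p => hrepeq _ _ rfl (hrep p)
  -- `X` enters `Z` by pairing `x` with its own class. Conversely `z` goes to a point of the class
  -- it names, with its code absorbed by `κ`.
  obtain ⟨Φ, hΦ⟩ := exists_measurableEquiv_over (Z := X) (Y := Z) (qZ := Quotient.mk E)
    (qY := fun z => actClass a z.1) (i := fun x => ⟨(x, rep (x, 1)), hrr (x, 1)⟩)
    (j := fun z => κ ((s z.1).1, c z.1))
    (Measurable.subtype_mk (measurable_id.prodMk (hrepm.comp (measurable_id.prodMk
      measurable_const))))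
    (hκm.comp (((measurable_fst.comp hsm).prodMk hcm).comp measurable_subtype_coe))
    (fun x y h => congrArg (fun z : Z => z.1.1) h)
    (fun z z' h => by
      have h1 := hκi h
      simp only [Prod.mk.injEq] at h1
      refine Subtype.ext (hsc (Prod.ext (Prod.ext h1.1 ?_) h1.2))
      exact (hsA z.1).trans (hsA z'.1).symm)
    (fun x => (hrep (x, 1)).trans (hone x))
    (fun z => by
      have h1 : actClass a z.1 = actClass a (s z.1) := hsE z.1
      have h2 : s z.1 = ((s z.1).1, 1) := Prod.ext rfl (hsA z.1)
      rw [h1, h2, hone]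
      exact (Quotient.sound (hκE _)).symm)
  -- The action keeps the `X` coordinate. As a point of `Z` is determined by that coordinate and the
  -- class it names (`hmext`), both the action laws and class-bijectivity can be checked on classes.
  let m : G → Z → Z := fun g z => ⟨(z.1.1, rep (z.1.1, g * z.1.2)), hrr (z.1.1, g * z.1.2)⟩
  have hmq : ∀ g z, actClass a (m g z).1 = a g (actClass a z.1) := fun g z =>
    (hrep _).trans (hmul g z.1)
  have hmext : ∀ z z' : Z, z.1.1 = z'.1.1 → actClass a z.1 = actClass a z'.1 → z = z' := by
    intro z z' h1 h2
    exact Subtype.ext (Prod.ext h1 (z.2.symm.trans ((hrepeq _ _ h1 h2).trans z'.2)))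
  have hm1 : ∀ z, m 1 z = z := fun z => hmext _ _ rfl (by rw [hmq, map_one, Equiv.Perm.one_apply])
  have hmm : ∀ g h z, m (g * h) z = m g (m h z) := fun g h z =>
    hmext _ _ rfl (by rw [hmq, hmq, hmq, map_mul, Equiv.Perm.mul_apply])
  have hmmeas : ∀ g, Measurable (m g) := fun g => by
    have h1 : Measurable fun p : X × G => (p.1, g * p.2) :=
      measurable_fst.prodMk ((measurable_of_countable (fun h => g * h)).comp measurable_snd)
    have h2 : Measurable fun p : X × G => (p.1, rep (p.1, g * p.2)) :=
      measurable_fst.prodMk (hrepm.comp h1)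
    exact Measurable.subtype_mk (h2.comp measurable_subtype_coe)
  let T : G → Equiv.Perm X := fun g =>
    { toFun := fun x => Φ.symm (m g (Φ x))
      invFun := fun x => Φ.symm (m g⁻¹ (Φ x))
      left_inv := fun x => by simp [← hmm, hm1]
      right_inv := fun x => by simp [← hmm, hm1] }
  have hTq : ∀ g x, Quotient.mk E (T g x) = a g (Quotient.mk E x) := fun g x => by
    rw [← hΦ, ← hΦ, ← hmq]
    simp [T]
  have hTE : ∀ g x y, E x y ↔ E (T g x) (T g y) := fun g x y => by
    have h1 : E x y ↔ Quotient.mk E x = Quotient.mk E y :=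
      ⟨fun h => Quotient.sound h, fun h => Quotient.exact h⟩
    have h2 : E (T g x) (T g y) ↔ Quotient.mk E (T g x) = Quotient.mk E (T g y) :=
      ⟨fun h => Quotient.sound h, fun h => Quotient.exact h⟩
    rw [h1, h2, hTq, hTq, (a g).injective.eq_iff]
  have hTm : ∀ g, T g ∈ autB E := fun g =>
    ⟨Φ.symm.measurable.comp ((hmmeas g).comp Φ.measurable),
      Φ.symm.measurable.comp ((hmmeas g⁻¹).comp Φ.measurable), hTE g⟩
  refine ⟨MonoidHom.mk' (fun g => ⟨T g, hTm g⟩) fun g h => ?_, fun g x => (hTq g x).symm,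
    fun g x hx => ?_⟩
  · refine Subtype.ext (Equiv.ext fun x => ?_)
    change Φ.symm (m (g * h) (Φ x)) = Φ.symm (m g (Φ (Φ.symm (m h (Φ x)))))
    rw [Φ.apply_symm_apply, hmm]
  · change Φ.symm (m g (Φ x)) = x
    have h1 : Quotient.mk E (T g x) = Quotient.mk E x := Quotient.sound hx
    rw [hTq, ← hΦ] at h1
    rw [hmext (m g (Φ x)) (Φ x) rfl (by rw [hmq]; exact h1), Φ.symm_apply_apply]

end lift


/-! ### Absorbing copies of `E × I_ℕ`. -/

/-- Countably many copies of `E × I_ℕ` embed into `E`. -/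
def AbsorbsProdNat {X : Type*} [MeasurableSpace X] (E : Setoid X) : Prop :=
  ∃ Ψ : X × ℕ × ℕ → X, Measurable Ψ ∧ Function.Injective Ψ ∧
    ∀ p q, E (Ψ p) (Ψ q) ↔ E p.1 q.1 ∧ p.2.1 = q.2.1

/-- The copies of `E × I_ℕ` can be chosen with invariant union. -/
theorem AbsorbsProdNat.exists_invariant {X : Type*} [MeasurableSpace X] [StandardBorelSpace X]
    {E : Setoid X} (hE : IsCBER E) (h : AbsorbsProdNat E) :
    ∃ (Y : Set X) (Φ : X × ℕ × ℕ ≃ᵐ Y), MeasurableSet Y ∧ (∀ x y, E x y → x ∈ Y → y ∈ Y) ∧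
      ∀ p q, E (Φ p) (Φ q) ↔ E p.1 q.1 ∧ p.2.1 = q.2.1 := by
  obtain ⟨Ψ, hΨ, hΨi, hΨE⟩ := h
  obtain ⟨γ, hγ⟩ := hE.exists_isGen
  have hemb := hΨ.measurableEmbedding hΨi
  let Y : Set X := {x | ∃ y, E x y ∧ y ∈ range Ψ}
  have hY : MeasurableSet Y := hγ.measurableSet_exists hemb.measurableSet_range
  have hYinv : ∀ x y, E x y → x ∈ Y → y ∈ Y := by
    rintro x y hxy ⟨z, hz, hzr⟩
    exact ⟨z, E.trans (E.symm hxy) hz, hzr⟩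
  have := hY.standardBorel
  -- Adding `Yᶜ` gives a complete section of all of `X`; points of `Y` are still sent into `range
  -- Ψ`.
  obtain ⟨s, c, hs, hc, hsA, hsE, hsc⟩ := hE.exists_code (A := range Ψ ∪ Yᶜ)
    (hemb.measurableSet_range.union hY.compl) (fun x => by
      by_cases hx : x ∈ Y
      · obtain ⟨y, hxy, hy⟩ := hx
        exact ⟨y, Or.inl hy, hxy⟩
      · exact ⟨x, Or.inr hx, E.refl x⟩)
  have hsr : ∀ y : Y, s y ∈ range Ψ := fun y =>
    (hsA y).resolve_right fun hn => hn (hYinv _ _ (hsE y) y.2)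
  let t : Y → X × ℕ × ℕ := fun y => hemb.equivRange.symm ⟨s y, hsr y⟩
  have ht : Measurable t := hemb.equivRange.symm.measurable.comp
    (Measurable.subtype_mk (hs.comp measurable_subtype_coe))
  have htΨ : ∀ y, Ψ (t y) = s y := fun y => by
    have := congrArg Subtype.val (hemb.equivRange.apply_symm_apply ⟨s y, hsr y⟩)
    rwa [hemb.equivRange_apply] at this
  have hpair : Measurable fun q : ℕ × ℕ => Nat.pair q.1 q.2 := measurable_of_countable _
  obtain ⟨Φ, hΦ⟩ := exists_measurableEquiv_over (Z := X × ℕ × ℕ) (Y := Y)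
    (qZ := fun p => Quotient.mk E (Ψ p)) (qY := fun y => Quotient.mk E (y : X))
    (i := fun p => ⟨Ψ p, Ψ p, E.refl _, mem_range_self p⟩)
    -- The code of `y` goes into the `I_ℕ` coordinate, which does not affect the class.
    (j := fun y => ((t y).1, (t y).2.1, Nat.pair (t y).2.2 (c y)))
    (Measurable.subtype_mk hΨ)
    ((measurable_fst.comp ht).prodMk (((measurable_fst.comp measurable_snd).comp ht).prodMk
      (hpair.comp (((measurable_snd.comp measurable_snd).comp ht).prodMk
        (hc.comp measurable_subtype_coe)))))
    (fun p q hpq => hΨi (congrArg Subtype.val hpq))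
    (fun y z hyz => by
      simp only [Prod.mk.injEq, Nat.pair_eq_pair] at hyz
      have h1 : t y = t z := Prod.ext hyz.1 (Prod.ext hyz.2.1 hyz.2.2.1)
      refine Subtype.ext (hsc (Prod.ext ?_ hyz.2.2.2))
      change s y = s z
      rw [← htΨ, ← htΨ, h1])
    (fun p => rfl)
    (fun y => by
      refine Quotient.sound (E.trans ((hΨE _ (t y)).2 ⟨E.refl _, rfl⟩) ?_)
      rw [htΨ]; exact E.symm (hsE y))
  refine ⟨Y, Φ, hY, hYinv, fun p q => ?_⟩
  rw [← hΨE]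
  have h1 : ∀ p, E (Φ p) (Ψ p) := fun p => Quotient.exact (hΦ p)
  exact ⟨fun h => E.trans (E.symm (h1 p)) (E.trans h (h1 q)),
    fun h => E.trans (h1 p) (E.trans h (E.symm (h1 q)))⟩

/-- `E` is isomorphic to the sum of `E` and of `H` copies of `E × I_ℕ`, for countable `H`. -/
theorem AbsorbsProdNat.exists_measurableEquiv_sum {X : Type*} [MeasurableSpace X]
    [StandardBorelSpace X] {E : Setoid X} (hE : IsCBER E) (h : AbsorbsProdNat E)
    (H : Type*) [Countable H] [MeasurableSpace H] [DiscreteMeasurableSpace H] :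
    ∃ Θ : X ⊕ (X × ℕ × H) ≃ᵐ X, (∀ x y, E (Θ (.inl x)) (Θ (.inl y)) ↔ E x y) ∧
      (∀ p q, E (Θ (.inr p)) (Θ (.inr q)) ↔ E p.1 q.1 ∧ p.2.2 = q.2.2) ∧
      ∀ x p, ¬ E (Θ (.inl x)) (Θ (.inr p)) := by
  classical
  obtain ⟨Y, Φ, hY, hYinv, hΦ⟩ := h.exists_invariant hE
  -- Hilbert's hotel: `u` moves the copies inside `Y` to the indices `σ (inl k)` and fixes
  -- everything else; `v` fills the freed indices `σ (inr l)`.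
  obtain ⟨σ⟩ : Nonempty (ℕ ⊕ H ≃ ℕ) := nonempty_equiv_of_countable
  let u : X → X := fun x => if h : x ∈ Y then
    Φ ((Φ.symm ⟨x, h⟩).1, σ (.inl (Φ.symm ⟨x, h⟩).2.1), (Φ.symm ⟨x, h⟩).2.2) else x
  let v : X × ℕ × H → X := fun p => Φ (p.1, σ (.inr p.2.2), p.2.1)
  have hu1 : ∀ p, u (Φ p) = Φ (p.1, σ (.inl p.2.1), p.2.2) := fun p => by
    have h1 : (Φ p : X) ∈ Y := (Φ p).2
    simp only [u, dif_pos h1, Subtype.coe_eta, Φ.symm_apply_apply]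
  have hu2 : ∀ x, x ∉ Y → u x = x := fun x hx => dif_neg hx
  have hYΦ : ∀ x ∈ Y, ∃ p, (Φ p : X) = x := fun x hx =>
    ⟨Φ.symm ⟨x, hx⟩, by rw [Φ.apply_symm_apply]⟩
  have hum : Measurable u := by
    refine measurable_of_restrict_of_restrict_compl hY ?_ ?_
    · have h1 : Y.domRestrict u = fun y => (Φ ((Φ.symm y).1, σ (.inl (Φ.symm y).2.1),
          (Φ.symm y).2.2) : X) := by
        funext y
        have := hu1 (Φ.symm y)
        rwa [Φ.apply_symm_apply] at this
      rw [h1]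
      have h2 : Measurable fun n : ℕ => σ (.inl n) := measurable_of_countable _
      have h3 := Φ.symm.measurable
      exact measurable_subtype_coe.comp (Φ.measurable.comp ((measurable_fst.comp h3).prodMk
        ((h2.comp ((measurable_fst.comp measurable_snd).comp h3)).prodMk
          ((measurable_snd.comp measurable_snd).comp h3))))
    · have h1 : Yᶜ.domRestrict u = fun y : (Yᶜ : Set X) => (y : X) := funext fun y => hu2 y y.2
      rw [h1]; exact measurable_subtype_coe
  have hvm : Measurable v := by
    have h2 : Measurable fun n : H => σ (.inr n) := measurable_of_countable _
    exact measurable_subtype_coe.comp (Φ.measurable.comp (measurable_fst.prodMk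
        ((h2.comp (measurable_snd.comp measurable_snd)).prodMk
          (measurable_fst.comp measurable_snd))))
  have hm : Measurable (Sum.elim u v) := Measurable.sumElim hum hvm
  have hΦi : ∀ p q, (Φ p : X) = Φ q → p = q := fun p q h => Φ.injective (Subtype.ext h)
  have hvY : ∀ p, v p ∈ Y := fun p => Subtype.coe_prop _
  have huY : ∀ x, u x ∈ Y ↔ x ∈ Y := fun x => by
    by_cases hx : x ∈ Y
    · obtain ⟨p, rfl⟩ := hYΦ x hx
      rw [hu1]; simp
    · rw [hu2 x hx]
  have hr1 : ∀ x y, E (u x) (u y) ↔ E x y := by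
    intro x y
    by_cases hx : x ∈ Y <;> by_cases hy : y ∈ Y
    · obtain ⟨p, rfl⟩ := hYΦ x hx
      obtain ⟨q, rfl⟩ := hYΦ y hy
      rw [hu1, hu1, hΦ, hΦ]
      simp
    · exact ⟨fun h => absurd ((huY y).1 (hYinv _ _ h ((huY x).2 hx))) hy,
        fun h => absurd (hYinv _ _ h hx) hy⟩
    · exact ⟨fun h => absurd ((huY x).1 (hYinv _ _ (E.symm h) ((huY y).2 hy))) hx,
        fun h => absurd (hYinv _ _ (E.symm h) hy) hx⟩
    · rw [hu2 x hx, hu2 y hy]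
  have hr2 : ∀ p q, E (v p) (v q) ↔ E p.1 q.1 ∧ p.2.2 = q.2.2 := by
    intro p q
    simp only [v]
    rw [hΦ]
    simp
  have hr3 : ∀ x p, ¬ E (u x) (v p) := by
    intro x p h
    have hx : x ∈ Y := (huY x).1 (hYinv _ _ (E.symm h) (hvY p))
    obtain ⟨q, rfl⟩ := hYΦ x hx
    rw [hu1] at h
    have := ((hΦ _ _).1 h).2
    simp at this
  have hui : ∀ x y, u x = u y → x = y := by
    intro x y h
    by_cases hx : x ∈ Y <;> by_cases hy : y ∈ Y
    · obtain ⟨p, rfl⟩ := hYΦ x hx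
      obtain ⟨q, rfl⟩ := hYΦ y hy
      rw [hu1, hu1] at h
      have h1 := hΦi _ _ h
      simp only [Prod.mk.injEq, EmbeddingLike.apply_eq_iff_eq, Sum.inl.injEq] at h1
      rw [show p = q from Prod.ext h1.1 (Prod.ext h1.2.1 h1.2.2)]
    · exact absurd ((huY y).1 (h ▸ (huY x).2 hx)) hy
    · exact absurd ((huY x).1 (h ▸ (huY y).2 hy)) hx
    · rwa [hu2 x hx, hu2 y hy] at h
  have hvi : ∀ p q, v p = v q → p = q := by
    intro p q h
    have h1 := hΦi _ _ h
    simp only [Prod.mk.injEq, EmbeddingLike.apply_eq_iff_eq, Sum.inr.injEq] at h1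
    exact Prod.ext h1.1 (Prod.ext h1.2.2 h1.2.1)
  have hbij : Function.Bijective (Sum.elim u v) := by
    constructor
    · rintro (x | p) (y | q) h
      · exact congrArg _ (hui x y h)
      · refine absurd ?_ (hr3 x q)
        rw [show u x = v q from h]
      · refine absurd ?_ (hr3 y p)
        rw [show v p = u y from h]
      · exact congrArg _ (hvi p q h)
    · intro x
      by_cases hx : x ∈ Y
      · obtain ⟨⟨a, k, n⟩, rfl⟩ := hYΦ x hx
        obtain ⟨l | l, rfl⟩ := σ.surjective k
        · exact ⟨.inl (Φ (a, l, n)), hu1 _⟩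
        · exact ⟨.inr (a, n, l), rfl⟩
      · exact ⟨.inl x, hu2 x hx⟩
  refine ⟨⟨Equiv.ofBijective _ hbij, hm, fun M hM => ?_⟩, hr1, hr2, hr3⟩
  rw [← Equiv.image_eq_preimage_symm]
  have him : Sum.elim u v '' M = u '' (Sum.inl ⁻¹' M) ∪ v '' (Sum.inr ⁻¹' M) := by
    ext x; simp
  change MeasurableSet (Sum.elim u v '' M)
  rw [him]
  exact ((hum.measurableEmbedding hui).measurableSet_image' (measurable_inl hM)).union
    ((hvm.measurableEmbedding hvi).measurableSet_image' (measurable_inr hM))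

theorem AbsorbsProdNat.borelIso {X : Type*} [MeasurableSpace X]
    [StandardBorelSpace X] {E : Setoid X} (hE : IsCBER E) (h : AbsorbsProdNat E) :
    BorelIso E (directSum E (prodNat E)) := by
  obtain ⟨Θ, h1, h2, h3⟩ := h.exists_measurableEquiv_sum hE Unit
  let e : X ⊕ (X × ℕ) ≃ᵐ X ⊕ (X × ℕ × Unit) := MeasurableEquiv.sumCongr (MeasurableEquiv.refl X)
    (MeasurableEquiv.prodCongr (MeasurableEquiv.refl X)
      { toFun := fun n => (n, ()), invFun := fun p => p.1, left_inv := fun _ => rfl,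
        right_inv := fun _ => rfl, measurable_toFun := measurable_of_countable _,
        measurable_invFun := measurable_of_countable _ })
  have key : ∀ z w, directSum E (prodNat E) z w ↔ E (Θ (e z)) (Θ (e w)) := by
    rintro (x | ⟨x, n⟩) (y | ⟨y, m⟩)
    · refine Iff.trans ?_ (h1 x y).symm
      exact Sum.liftRel_inl_inl
    · exact iff_of_false (fun hh => by cases hh) (h3 x _)
    · exact iff_of_false (fun hh => by cases hh) (fun hh => h3 y _ (E.symm hh))
    · refine Iff.trans ?_ (h2 (x, n, ()) (y, m, ())).symm
      refine Iff.trans Sum.liftRel_inr_inr ?_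
      exact ⟨fun hh => ⟨hh.1, rfl⟩, fun hh => ⟨hh.1, trivial⟩⟩
  refine ⟨(e.trans Θ).symm, fun x y => ?_⟩
  rw [key]
  change _ ↔ E ((e.trans Θ) _) ((e.trans Θ) _)
  rw [MeasurableEquiv.apply_symm_apply, MeasurableEquiv.apply_symm_apply]

/-- With `r` and `w` the embeddings of the two summands, the copies are the images of `r^[k] ∘ w`.
For `k ≠ l`, cancelling the common iterates of `r` leaves a point in the range of `w` against one in
the range of `r`, and these are never related. -/
theorem BorelIso.absorbsProdNat {X : Type*} [MeasurableSpace X] {E : Setoid X}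
    (h : BorelIso E (directSum E (prodNat E))) : AbsorbsProdNat E := by
  obtain ⟨Φ, hΦ⟩ := h
  let r : X → X := fun x => Φ.symm (.inl x)
  let w : X × ℕ → X := fun p => Φ.symm (.inr p)
  have hr : ∀ x y, E (r x) (r y) ↔ E x y := fun x y => by
    rw [hΦ, Φ.apply_symm_apply, Φ.apply_symm_apply]; exact Sum.liftRel_inl_inl
  have hw : ∀ p q, E (w p) (w q) ↔ E p.1 q.1 := fun p q => by
    rw [hΦ, Φ.apply_symm_apply, Φ.apply_symm_apply]
    exact Sum.liftRel_inr_inr.trans ⟨fun h => h.1, fun h => ⟨h, trivial⟩⟩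
  have hwr : ∀ p x, ¬ E (w p) (r x) := fun p x h => by
    rw [hΦ, Φ.apply_symm_apply, Φ.apply_symm_apply] at h; cases h
  have hrm : Measurable r := Φ.symm.measurable.comp measurable_inl
  have hwm : Measurable w := Φ.symm.measurable.comp measurable_inr
  have hri : Function.Injective r := Φ.symm.injective.comp Sum.inl_injective
  have hwi : Function.Injective w := Φ.symm.injective.comp Sum.inr_injective
  have key : ∀ k l p q, E (r^[k] (w p)) (r^[l] (w q)) ↔ E p.1 q.1 ∧ k = l := by
    intro k
    induction k with
    | zero =>
      intro l p q
      cases l with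
      | zero => simpa using hw p q
      | succ l =>
        rw [Function.iterate_succ_apply']
        exact iff_of_false (hwr _ _) (by simp)
    | succ k ih =>
      intro l p q
      cases l with
      | zero =>
        rw [Function.iterate_succ_apply']
        exact iff_of_false (fun h => hwr _ _ (E.symm h)) (by simp)
      | succ l =>
        rw [Function.iterate_succ_apply', Function.iterate_succ_apply', hr, ih]
        simp
  refine ⟨fun p => r^[p.2.1] (w (p.1, p.2.2)), ?_, ?_, fun p q => key _ _ _ _⟩
  · exact measurable_apply_nat (γ := fun n => r^[n]) (fun n => hrm.iterate n)
      (measurable_fst.comp measurable_snd)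
      (hwm.comp (measurable_fst.prodMk (measurable_snd.comp measurable_snd)))
  · rintro ⟨x, k, n⟩ ⟨y, l, m⟩ h
    have h' : r^[k] (w (x, n)) = r^[l] (w (y, m)) := h
    obtain rfl : k = l := ((key k l (x, n) (y, m)).1 (by rw [h'])).2
    have h2 := hwi (hri.iterate k h')
    simp only [Prod.mk.injEq] at h2
    rw [h2.1, h2.2]

theorem isCompressible_of_prod_nat {X : Type*} [MeasurableSpace X] {E : Setoid X}
    {κ : X × ℕ → X} (hκ : Measurable κ) (hi : Function.Injective κ) (hE : ∀ p, E p.1 (κ p)) :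
    IsCompressible E := by
  refine ⟨fun x => κ (x, 0), hκ.comp (measurable_id.prodMk measurable_const), fun x y h => ?_,
    fun x => ?_⟩
  · exact congrArg Prod.fst (hi h)
  · rw [ssubset_iff_exists]
    refine ⟨?_, κ (x, 1), hE (x, 1), ?_⟩
    · rintro _ ⟨y, hy, rfl⟩
      exact E.trans hy (hE (y, 0))
    · rintro ⟨y, -, h⟩
      have := congrArg Prod.snd (hi h)
      simp at this

/-- If `E` absorbs `E × I_ℕ` and all Borel actions of some nontrivial countable group on the
quotient are outer, then `E` is compressible. -/
theorem AbsorbsProdNat.isCompressible_of_outer {X : Type*} [MeasurableSpace X]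
    [StandardBorelSpace X] {E : Setoid X} (hE : IsCBER E) (h : AbsorbsProdNat E)
    (G : Type*) [Group G] [Countable G] [Nontrivial G]
    (hG : ∀ a : G →* Equiv.Perm (Quotient E), IsBorelAction E a → IsOuterAction E a) :
    IsCompressible E := by
  classical
  let : MeasurableSpace G := ⊤
  have : DiscreteMeasurableSpace G := ⟨fun _ => trivial⟩
  obtain ⟨Θ, h1, h2, h3⟩ := h.exists_measurableEquiv_sum hE {g : G // g ≠ 1}
  let P' : X ⊕ (X × ℕ × {g : G // g ≠ 1}) → X × G :=
    Sum.elim (fun x => (x, 1)) (fun p => (p.1, p.2.2.1))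
  have hP' : Measurable P' := Measurable.sumElim (measurable_id.prodMk measurable_const)
    (measurable_fst.prodMk (measurable_subtype_coe.comp (measurable_snd.comp measurable_snd)))
  -- `P` records the underlying point and the sheet; sheet `1` is a copy of `E` and the others are
  -- copies of `E × I_ℕ`. On classes it becomes the bijection `θ` of `X/E` with `X/E × G`.
  let P : X → X × G := fun x => P' (Θ.symm x)
  have hP : Measurable P := hP'.comp Θ.symm.measurable
  have hPinl : ∀ x, P (Θ (.inl x)) = (x, 1) := fun x => by simp [P, P']
  have hPinr : ∀ p, P (Θ (.inr p)) = (p.1, p.2.2.1) := fun x => by simp [P, P']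
  have hPE : ∀ x y, E x y ↔ E (P x).1 (P y).1 ∧ (P x).2 = (P y).2 := by
    intro x y
    obtain ⟨z, rfl⟩ := Θ.surjective x
    obtain ⟨w, rfl⟩ := Θ.surjective y
    rcases z with x | p <;> rcases w with y | q
    · rw [hPinl, hPinl, h1]; simp
    · rw [hPinl, hPinr]
      exact iff_of_false (h3 _ _) (fun h => q.2.2.2 h.2.symm)
    · rw [hPinl, hPinr]
      exact iff_of_false (fun h => h3 _ _ (E.symm h)) (fun h => p.2.2.2 h.2)
    · rw [hPinr, hPinr, h2, Subtype.ext_iff]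
  have hPs : Function.Surjective P := by
    rintro ⟨x, g⟩
    by_cases hg : g = 1
    · exact ⟨Θ (.inl x), by rw [hPinl, hg]⟩
    · exact ⟨Θ (.inr (x, 0, ⟨g, hg⟩)), by rw [hPinr]⟩
  have hP1 : ∀ x, (P x).2 = 1 → x = Θ (.inl (P x).1) := by
    intro x hx
    obtain ⟨z, rfl⟩ := Θ.surjective x
    rcases z with x | p
    · rw [hPinl]
    · rw [hPinr] at hx
      exact absurd hx p.2.2.2
  let θ' : Quotient E → Quotient E × G := Quotient.lift (fun x => (Quotient.mk E (P x).1, (P x).2))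
    fun x y hxy => Prod.ext (Quotient.sound ((hPE x y).1 hxy).1) ((hPE x y).1 hxy).2
  have hθ' : Function.Bijective θ' := by
    constructor
    · rintro ⟨x⟩ ⟨y⟩ hxy
      have hxy' : (Quotient.mk E (P x).1, (P x).2) = (Quotient.mk E (P y).1, (P y).2) := hxy
      simp only [Prod.mk.injEq] at hxy'
      exact Quotient.sound ((hPE x y).2 ⟨Quotient.exact hxy'.1, hxy'.2⟩)
    · rintro ⟨⟨x⟩, g⟩
      obtain ⟨y, hy⟩ := hPs (x, g)
      refine ⟨Quotient.mk E y, ?_⟩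
      change (Quotient.mk E (P y).1, (P y).2) = _
      rw [hy]; rfl
  let θ : Quotient E ≃ Quotient E × G := Equiv.ofBijective θ' hθ'
  let L : G →* Equiv.Perm (Quotient E × G) := MonoidHom.mk'
    (fun g => Equiv.prodCongr (Equiv.refl _) (Equiv.mulLeft g)) fun g h => by
      ext ⟨q, k⟩ <;> simp [mul_assoc]
  let a : G →* Equiv.Perm (Quotient E) := θ.symm.permCongrHom.toMonoidHom.comp L
  have ha : ∀ g q, θ (a g q) = ((θ q).1, g * (θ q).2) := fun g q => by
    change θ (θ.symm (L g (θ q))) = _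
    rw [θ.apply_symm_apply]; rfl
  have hθ : ∀ x, θ (Quotient.mk E x) = (Quotient.mk E (P x).1, (P x).2) := fun x => rfl
  have ha' : ∀ g x y, a g (Quotient.mk E x) = Quotient.mk E y ↔
      E (P x).1 (P y).1 ∧ g * (P x).2 = (P y).2 := by
    intro g x y
    rw [← θ.injective.eq_iff, ha, hθ, hθ, Prod.mk.injEq, Quotient.eq]
  have hB : IsBorelAction E a := by
    intro g
    unfold IsBorelPerm
    simp only [ha']
    refine MeasurableSet.inter ?_ ?_
    · exact ((measurable_fst.comp (hP.comp measurable_fst)).prodMk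
        (measurable_fst.comp (hP.comp measurable_snd))) hE.measurableSet_graph
    · exact measurableSet_eq_fun ((measurable_of_countable (fun k => g * k)).comp
        (measurable_snd.comp (hP.comp measurable_fst)))
        (measurable_snd.comp (hP.comp measurable_snd))
  obtain ⟨g, hg⟩ := exists_ne (1 : G)
  obtain ⟨⟨T, hTm⟩, hT⟩ := hG a hB g
  have hT' : ∀ x, E (P x).1 (P (T x)).1 ∧ g * (P x).2 = (P (T x)).2 := fun x =>
    (ha' g x (T x)).1 (hT x)
  -- `T` induces translation by `g`, so its inverse takes sheet `g`, which is `X × ℕ`, into sheet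
  -- `1`, which is `X`, without changing the underlying class.
  let S : X × ℕ → X := fun p => T.symm (Θ (.inr (p.1, p.2, ⟨g, hg⟩)))
  have hSm : Measurable S := hTm.2.1.comp (Θ.measurable.comp (measurable_inr.comp
    (measurable_fst.prodMk (measurable_snd.prodMk measurable_const))))
  have hS : ∀ p, E p.1 (P (S p)).1 ∧ (P (S p)).2 = 1 := fun p => by
    have := hT' (S p)
    simp only [S, Equiv.apply_symm_apply, hPinr] at this
    exact ⟨E.symm this.1, by simpa using this.2⟩
  refine isCompressible_of_prod_nat (κ := fun p => (P (S p)).1)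
    (measurable_fst.comp (hP.comp hSm)) (fun p q hpq => ?_) fun p => (hS p).1
  have h4 : S p = S q := by
    rw [hP1 _ (hS p).2, hP1 _ (hS q).2]
    exact congrArg _ (congrArg _ hpq)
  have h5 := Sum.inr_injective (Θ.injective (T.symm.injective h4))
  simp only [Prod.mk.injEq, and_true] at h5
  exact Prod.ext h5.1 h5.2


/-! ### Smooth relations. -/

/-- `E` restricted to `V` is smooth. -/
def IsSmoothOn {X : Type*} [MeasurableSpace X] (E : Setoid X) (V : Set X) : Prop :=
  ∃ s : X → ℝ, Measurable s ∧ ∀ x ∈ V, ∀ y ∈ V, E x y ↔ s x = s y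

/-- The least point of the finite nonempty set `A ∩ [x]`, in a Borel linear order, is a complete
invariant of the class. -/
theorem IsCBER.isSmoothOn_of_finite {X : Type*} [MeasurableSpace X] [StandardBorelSpace X]
    {E : Setoid X} (hE : IsCBER E) {A V : Set X} (hA : MeasurableSet A)
    (hne : ∀ x ∈ V, ∃ y ∈ A, E x y) (hfin : ∀ x ∈ V, {y | y ∈ A ∧ E x y}.Finite) :
    IsSmoothOn E V := by
  classical
  obtain ⟨γ, hγ⟩ := hE.exists_isGen
  -- The exponential makes the real code positive, so that it stays injective in `ENNReal`; there
  -- the infimum over all `γ i x` exists, with `⊤` for points outside `A`.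
  let val : X → ENNReal := fun x => ENNReal.ofReal (Real.exp (embeddingReal X x))
  have hval : Measurable val := ENNReal.measurable_ofReal.comp
    (Real.measurable_exp.comp (measurable_embeddingReal X))
  have hvi : Function.Injective val := fun x y h => by
    simp only [val] at h
    rw [ENNReal.ofReal_eq_ofReal_iff (Real.exp_pos _).le (Real.exp_pos _).le] at h
    exact (measurableEmbedding_embeddingReal X).injective (Real.exp_injective h)
  let m : X → ENNReal := fun x => ⨅ i, if γ i x ∈ A then val (γ i x) else ⊤
  have hm : Measurable m := .iInf fun i => Measurable.ite (hγ.measurable i hA)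
    (hval.comp (hγ.measurable i)) measurable_const
  have hle : ∀ x y, y ∈ A → E x y → m x ≤ val y := by
    intro x y hy hxy
    obtain ⟨i, rfl⟩ := (hγ.rel x y).1 hxy
    exact (iInf_le _ i).trans_eq (if_pos hy)
  have hmin : ∀ x ∈ V, ∃ y ∈ A, E x y ∧ m x = val y := by
    intro x hx
    obtain ⟨z, hz, hzmin⟩ := Set.exists_min_image _ val (hfin x hx)
      (by obtain ⟨y, hy, hxy⟩ := hne x hx; exact ⟨y, hy, hxy⟩)
    refine ⟨z, hz.1, hz.2, le_antisymm (hle x z hz.1 hz.2) (le_iInf fun i => ?_)⟩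
    split_ifs with h
    · exact hzmin _ ⟨h, hγ.rel_apply i x⟩
    · exact le_top
  refine ⟨fun x => (m x).toReal, hm.ennreal_toReal, fun x hx y hy => ?_⟩
  obtain ⟨a, ha, hxa, hma⟩ := hmin x hx
  obtain ⟨b, hb, hyb, hmb⟩ := hmin y hy
  constructor
  · intro hxy
    refine congrArg _ (le_antisymm ?_ ?_)
    · rw [hmb]; exact hle x b hb (E.trans hxy hyb)
    · rw [hma]; exact hle y a ha (E.trans (E.symm hxy) hxa)
  · intro h
    simp only [hma, hmb] at h
    rw [ENNReal.toReal_eq_toReal_iff' ENNReal.ofReal_ne_top ENNReal.ofReal_ne_top] at h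
    obtain rfl := hvi h
    exact E.trans hxa (E.symm hyb)

theorem IsCBER.countable_fibre {X : Type*} [MeasurableSpace X] {E : Setoid X} (hE : IsCBER E)
    {Y : Type*} {s : X → Y} (hs : ∀ x y, s x = s y → E x y) (r : Y) : (s ⁻¹' {r}).Countable := by
  rcases (s ⁻¹' {r}).eq_empty_or_nonempty with h | ⟨x, hx⟩
  · rw [h]; exact countable_empty
  · exact (hE.countable_class x).mono fun y hy => hs x y (Eq.trans hx (Eq.symm hy))

theorem IsCBER.exists_label_of_isSmoothOn {X : Type*} [MeasurableSpace X] [StandardBorelSpace X]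
    {E : Setoid X} (hE : IsCBER E) (hs : IsSmoothOn E univ) :
    ∃ l : X → ℕ, Measurable l ∧ ∀ x y, E x y → l x = l y → x = y := by
  obtain ⟨s, hsm, hsE⟩ := hs
  have hsE' : ∀ x y, E x y ↔ s x = s y := fun x y => hsE x trivial y trivial
  obtain ⟨l, hl, hli⟩ := exists_label hsm (hE.countable_fibre fun x y h => (hsE' x y).2 h)
  exact ⟨l, hl, fun x y hxy hlxy => hli (Prod.ext ((hsE' x y).1 hxy) hlxy)⟩

/-- An aperiodic smooth relation is compressible. -/
theorem IsCBER.isCompressible_of_isSmoothOn {X : Type*} [MeasurableSpace X] [StandardBorelSpace X]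
    {E : Setoid X} (hE : IsCBER E) (hap : IsAperiodic E) (hs : IsSmoothOn E univ) :
    IsCompressible E := by
  classical
  obtain ⟨γ, hγ⟩ := hE.exists_isGen
  obtain ⟨l, hl, hli⟩ := hE.exists_label_of_isSmoothOn hs
  have hex : ∀ x, ∃ m, l x < m ∧ ∃ y, E x y ∧ l y = m := by
    intro x
    have hinf : (l '' {y | E x y}).Infinite := (hap x).image fun y hy z hz h =>
      hli y z (E.trans (E.symm hy) hz) h
    obtain ⟨_, ⟨y, hy, rfl⟩, hlt⟩ := hinf.exists_gt (l x)
    exact ⟨l y, hlt, y, hy, rfl⟩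
  -- Labels identify each class with an infinite subset of `ℕ`. The compression `T` is the successor
  -- map, which misses the point of least label.
  let m : X → ℕ := fun x => Nat.find (hex x)
  have hlm : ∀ k, MeasurableSet {y | l y = k} := fun k => hl (measurableSet_singleton k)
  have hm : Measurable m := measurable_find hex fun k => by
    refine MeasurableSet.inter ?_ (hγ.measurableSet_exists (hlm k))
    exact measurableSet_lt hl measurable_const
  have hm1 : ∀ x, l x < m x := fun x => (Nat.find_spec (hex x)).1
  have hm2 : ∀ x y, E x y → l x < l y → m x ≤ l y := fun x y hxy h =>
    Nat.find_min' (hex x) ⟨h, y, hxy, rfl⟩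
  have hex2 : ∀ x, ∃ i, l (γ i x) = m x := fun x => by
    obtain ⟨y, hxy, hy⟩ := (Nat.find_spec (hex x)).2
    obtain ⟨i, rfl⟩ := (hγ.rel x y).1 hxy
    exact ⟨i, hy⟩
  let T : X → X := fun x => γ (Nat.find (hex2 x)) x
  have hTl : ∀ x, l (T x) = m x := fun x => Nat.find_spec (hex2 x)
  have hTE : ∀ x, E x (T x) := fun x => hγ.rel_apply _ _
  have hTm : Measurable T := measurable_apply_nat hγ.measurable (measurable_find hex2 fun i =>
    measurableSet_eq_fun (hl.comp (hγ.measurable i)) hm) measurable_id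
  refine ⟨T, hTm, fun x y hxy => ?_, fun x => ?_⟩
  · have hE' : E x y := E.trans (hTE x) (hxy ▸ E.symm (hTE y))
    have hmm : m x = m y := by rw [← hTl, ← hTl, hxy]
    refine hli x y hE' ?_
    rcases lt_trichotomy (l x) (l y) with h | h | h
    · have := hm2 x y hE' h
      have := hm1 y
      omega
    · exact h
    · have := hm2 y x (E.symm hE') h
      have := hm1 x
      omega
  · rw [ssubset_iff_exists]
    refine ⟨?_, ?_⟩
    · rintro _ ⟨y, hy, rfl⟩
      exact E.trans hy (hTE y)
    · have hex3 : ∃ k y, E x y ∧ l y = k := ⟨_, x, E.refl x, rfl⟩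
      obtain ⟨y, hxy, hy⟩ := Nat.find_spec hex3
      refine ⟨y, hxy, ?_⟩
      rintro ⟨z, hz, rfl⟩
      rw [hTl] at hy
      have h1 := hm1 z
      have h2 := Nat.find_min' hex3 ⟨z, hz, rfl⟩
      omega

/-! ### Hyperfinite relations reduce to equality modulo finite sets. -/

/-- Every hyperfinite relation is Borel reducible to equality modulo finite sets. -/
theorem IsHyperfinite.exists_reduction {X : Type*} [MeasurableSpace X] [StandardBorelSpace X]
    {E : Setoid X} (hE : IsHyperfinite E) :
    ∃ h : X → (ℕ × ℕ × ℕ × List Bool → Bool), Measurable h ∧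
      ∀ x y, E x y ↔ {i | h x i ≠ h y i}.Finite := by
  classical
  obtain ⟨F, hFm, hFf, hFs, hFE⟩ := hE
  have hF : ∀ n, IsCBER (F n) := fun n => ⟨hFm n, fun x => (hFf n x).countable⟩
  have hmono : ∀ n m, n ≤ m → ∀ x y, F n x y → F m x y := by
    intro n m hnm x y h
    induction hnm with
    | refl => exact h
    | step _ ih => exact hFs _ _ _ ih
  have hl : ∀ n, ∃ l : X → ℕ, Measurable l ∧ ∀ x y, F n x y → l x = l y → x = y := fun n =>
    (hF n).exists_label_of_isSmoothOn ((hF n).isSmoothOn_of_finite (A := univ) .univ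
      (fun x _ => ⟨x, trivial, (F n).refl x⟩) fun x _ => by simpa using hFf n x)
  choose l hlm hli using hl
  obtain ⟨e, he, hei⟩ := MeasurableSpace.measurable_injection_nat_bool_of_countablySeparated X
  let d : ℕ → X → List Bool := fun n x => (List.range n).map (e x)
  have hd : ∀ n x y, d n x = d n y ↔ ∀ k < n, e x k = e y k := by
    intro n x y
    simp [d, List.map_inj_left]
  have hdm : ∀ n t, MeasurableSet {x | d n x = t} := by
    intro n
    induction n with
    | zero => intro t; exact .const ([] = t)
    | succ n ih =>
      intro t
      have h1 : ∀ x, d (n + 1) x = d n x ++ [e x n] := fun x => by simp [d, List.range_succ]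
      have h2 : {x | d (n + 1) x = t} = ⋃ t' : List Bool, ⋃ b : Bool,
          {x | d n x = t'} ∩ ({x | e x n = b} ∩ {_x | t' ++ [b] = t}) := by
        ext x
        simp only [mem_iUnion]
        constructor
        · intro h; exact ⟨_, _, rfl, rfl, (h1 x).symm.trans h⟩
        · rintro ⟨t', b, hx1, hx2, hx3⟩
          have hx1' : d n x = t' := hx1
          have hx2' : e x n = b := hx2
          have hx3' : t' ++ [b] = t := hx3
          change d (n + 1) x = t
          rw [h1, hx1', hx2', hx3']
      rw [h2]
      exact .iUnion fun t' => .iUnion fun b => (ih t').inter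
        ((((measurable_pi_apply n).comp he) (measurableSet_singleton b)).inter (.const _))
  -- Level `n` of the code lists, for each `z` in the finite `F n`-class, its labels at levels `n`
  -- and `n + 1` and its first `n` binary digits. Only finitely many bits per level are set, and `F
  -- N`-related points agree from level `N` on.
  let Q : ℕ × ℕ × ℕ × List Bool → Set X := fun i =>
    {z | l i.1 z = i.2.1 ∧ l (i.1 + 1) z = i.2.2.1 ∧ d i.1 z = i.2.2.2}
  have hQ : ∀ i, MeasurableSet (Q i) := fun i =>
    ((hlm _) (measurableSet_singleton i.2.1)).inter
      (((hlm _) (measurableSet_singleton i.2.2.1)).inter (hdm _ _))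
  let h : X → (ℕ × ℕ × ℕ × List Bool → Bool) := fun x i => decide (∃ z, F i.1 x z ∧ z ∈ Q i)
  have hh : ∀ x i, h x i = true ↔ ∃ z, F i.1 x z ∧ z ∈ Q i := fun x i => decide_eq_true_iff
  refine ⟨h, ?_, fun x y => ⟨fun hxy => ?_, fun hfin => ?_⟩⟩
  · refine measurable_pi_lambda _ fun i => ?_
    obtain ⟨γ, hγ⟩ := (hF i.1).exists_isGen
    refine measurable_to_bool ?_
    have : (fun x => h x i) ⁻¹' {true} = {x | ∃ z, F i.1 x z ∧ z ∈ Q i} := by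
      ext x; exact hh x i
    rw [this]
    exact hγ.measurableSet_exists (hQ i)
  · obtain ⟨N, hN⟩ := (hFE x y).1 hxy
    have hfinx : ∀ x, {i | i.1 < N ∧ h x i = true}.Finite := by
      intro x
      have : {i | i.1 < N ∧ h x i = true} ⊆ ⋃ n ∈ Finset.range N,
          (fun z => (n, l n z, l (n + 1) z, d n z)) '' {z | F n x z} := by
        rintro ⟨n, a, b, t⟩ ⟨hn, hi⟩
        obtain ⟨z, hz, hz1, hz2, hz3⟩ := (hh x _).1 hi
        have e1 : l n z = a := hz1
        have e2 : l (n + 1) z = b := hz2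
        have e3 : d n z = t := hz3
        refine mem_iUnion₂.2 ⟨n, Finset.mem_range.2 hn, z, hz, ?_⟩
        simp only [e1, e2, e3]
      refine Finite.subset ?_ this
      exact Finite.biUnion (Finset.finite_toSet _) fun n _ => (hFf n x).image _
    refine ((hfinx x).union (hfinx y)).subset fun i hi => ?_
    have hlt : i.1 < N := by
      by_contra hge
      apply hi
      have hn := hmono N i.1 (not_lt.1 hge) x y hN
      rw [Bool.eq_iff_iff, hh, hh]
      exact ⟨fun ⟨z, hz, hzQ⟩ => ⟨z, (F _).trans ((F _).symm hn) hz, hzQ⟩,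
        fun ⟨z, hz, hzQ⟩ => ⟨z, (F _).trans hn hz, hzQ⟩⟩
    cases hx : h x i with
    | true => exact Or.inl ⟨hlt, hx⟩
    | false =>
      refine Or.inr ⟨hlt, ?_⟩
      have hi' : h x i ≠ h y i := hi
      rw [hx] at hi'
      exact Bool.eq_true_of_not_eq_false (Ne.symm hi')
  · obtain ⟨N, hN⟩ := (hfin.image Prod.fst).bddAbove
    have heq : ∀ n > N, ∀ t, h x (n, t) = h y (n, t) := by
      intro n hn t
      by_contra hne
      exact absurd (hN ⟨(n, t), hne, rfl⟩) (not_le.2 hn)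
    -- At each high level `y` has a companion `w n` that looks like `x`. The label at level `n + 1`
    -- forces `w (n + 1) = w n`, so the companion is constant; all its digits agree with those of
    -- `x`, hence it is `x`.
    have hw : ∀ n > N, ∃ w, F n y w ∧ l n w = l n x ∧ l (n + 1) w = l (n + 1) x ∧
        d n w = d n x := by
      intro n hn
      have h1 : h x (n, l n x, l (n + 1) x, d n x) = true :=
        (hh _ _).2 ⟨x, (F n).refl x, rfl, rfl, rfl⟩
      rw [heq n hn, hh] at h1
      exact h1
    have : Nonempty X := ⟨x⟩
    choose! w hw1 hw2 hw3 hw4 using hw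
    have hstep : ∀ n > N, w (n + 1) = w n := by
      intro n hn
      refine hli (n + 1) _ _ ((F (n + 1)).trans ((F (n + 1)).symm (hw1 (n + 1) (by omega)))
        (hFs _ _ _ (hw1 n hn))) ?_
      rw [hw2 (n + 1) (by omega), hw3 n hn]
    have hconst : ∀ k, w (N + 1 + k) = w (N + 1) := by
      intro k
      induction k with
      | zero => rfl
      | succ k ih => exact (hstep (N + 1 + k) (by omega)).trans ih
    have hwx : w (N + 1) = x := by
      refine hei (funext fun k => ?_)
      have hlt : N < N + 1 + k := by omega
      have := (hd _ _ _).1 (hw4 (N + 1 + k) hlt) k (by omega)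
      rwa [hconst] at this
    have := hw1 (N + 1) (by omega)
    rw [hwx] at this
    exact E.symm ((hFE _ _).2 ⟨_, this⟩)


/-! ### The Glimm–Effros dichotomy. -/

theorem borelSpace_of_le {X : Type*} [MeasurableSpace X] {t t' : TopologicalSpace X}
    (ht : @PolishSpace X t) (hb : @BorelSpace X t _) (ht' : @PolishSpace X t') (h : t' ≤ t) :
    @BorelSpace X t' _ :=
  @BorelSpace.mk X t' _ (hb.measurable_eq.trans (borel_eq_borel_of_le ht' ht h).symm)

/-- Countably many Borel self-maps are continuous for some compatible Polish topology. -/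
theorem exists_polish_continuous {X : Type*} [MeasurableSpace X] [StandardBorelSpace X]
    {γ : ℕ → X → X} (hγ : ∀ i, Measurable (γ i)) :
    ∃ t : TopologicalSpace X, @PolishSpace X t ∧ @BorelSpace X t _ ∧
      ∀ i, @Continuous X X t t (γ i) := by
  let St := {t : TopologicalSpace X // @PolishSpace X t ∧ @BorelSpace X t _}
  have step : ∀ t : St, ∃ t' : St, t'.1 ≤ t.1 ∧ ∀ i, @Continuous X X t'.1 t.1 (γ i) := by
    rintro ⟨t, htp, htb⟩
    have h1 : ∀ i, ∃ t' : TopologicalSpace X, t' ≤ t ∧ @Continuous X X t' t (γ i) ∧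
        @PolishSpace X t' := fun i => (hγ i).exists_continuous
    choose m hm hmc hmp using h1
    obtain ⟨t', ht'm, ht't, ht'p⟩ := PolishSpace.exists_polishSpace_forall_le m hm hmp
    exact ⟨⟨t', ht'p, borelSpace_of_le htp htb ht'p ht't⟩, ht't,
      fun i => continuous_le_dom (ht'm i) (hmc i)⟩
  choose nxt hle hcont using step
  obtain ⟨t₀, hb₀, hp₀⟩ := StandardBorelSpace.polish (α := X)
  -- Each topology makes every `γ i` continuous into the previous one, so for the topology generated
  -- by all of them every `γ i` is continuous into itself.
  let T : ℕ → St := fun n => Nat.rec ⟨t₀, hp₀, hb₀⟩ (fun _ t => nxt t) n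
  have hT : ∀ n, (T (n + 1)).1 ≤ (T n).1 := fun n => hle _
  have hT0 : ∀ n, (T n).1 ≤ (T 0).1 := by
    intro n
    induction n with
    | zero => exact le_rfl
    | succ n ih => exact (hT n).trans ih
  have hp : @PolishSpace X (⨅ n, (T n).1) := PolishSpace.iInf ⟨0, hT0⟩ fun n => (T n).2.1
  refine ⟨⨅ n, (T n).1, hp, borelSpace_of_le (T 0).2.1 (T 0).2.2 hp (iInf_le _ 0), fun i => ?_⟩
  rw [continuous_iInf_rng]
  intro n
  exact continuous_le_dom (iInf_le _ (n + 1)) (hcont (T n) i)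

/-- The least `n` with `x ∈ V n` is constant on classes by invariance; paired with the invariant for
that `V n`, it classifies the union. -/
theorem isSmoothOn_iUnion {X : Type*} [MeasurableSpace X] {E : Setoid X} {V : ℕ → Set X}
    (hV : ∀ n, MeasurableSet (V n)) (hinv : ∀ n x y, E x y → x ∈ V n → y ∈ V n)
    (hs : ∀ n, IsSmoothOn E (V n)) : IsSmoothOn E (⋃ n, V n) := by
  classical
  choose s hsm hsE using hs
  have hex : ∀ x, ∃ n, x ∈ V n ∨ x ∉ ⋃ n, V n := fun x => by
    by_cases hx : x ∈ ⋃ n, V n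
    · obtain ⟨n, hn⟩ := mem_iUnion.1 hx; exact ⟨n, Or.inl hn⟩
    · exact ⟨0, Or.inr hx⟩
  let N : X → ℕ := fun x => Nat.find (hex x)
  have hN : Measurable N := measurable_find hex fun n => (hV n).union (MeasurableSet.iUnion hV).compl
  have hNV : ∀ x ∈ ⋃ n, V n, x ∈ V (N x) := fun x hx =>
    (Nat.find_spec (hex x)).resolve_right fun h => h hx
  have hNle : ∀ x n, x ∈ V n → N x ≤ n := fun x n hx => Nat.find_min' (hex x) (Or.inl hx)
  refine ⟨fun x => embeddingReal (ℕ × ℝ) (N x, s (N x) x), (measurable_embeddingReal _).comp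
    (hN.prodMk (measurable_apply_nat hsm hN measurable_id)), fun x hx y hy => ?_⟩
  rw [(measurableEmbedding_embeddingReal (ℕ × ℝ)).injective.eq_iff, Prod.mk.injEq]
  constructor
  · intro hxy
    have h1 : N x = N y := le_antisymm (hNle x _ (hinv _ y x (E.symm hxy) (hNV y hy)))
      (hNle y _ (hinv _ x y hxy (hNV x hx)))
    refine ⟨h1, ?_⟩
    rw [← h1]
    exact (hsE _ x (hNV x hx) y (hinv _ x y hxy (hNV x hx))).1 hxy
  · rintro ⟨h1, h2⟩
    rw [← h1] at h2
    refine (hsE _ x (hNV x hx) y ?_).2 h2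
    rw [h1]; exact hNV y hy

section embedding

variable {X : Type*} [MetricSpace X] {E : Setoid X} {γ : ℕ → X ≃ₜ X}

/-- A recurrent point `x` has infinitely many equivalent points in `U`, so one of them, `γ i x`,
avoids the finitely many `v⁻¹ (w x)` and `v⁻¹ (γ j (w x))`. By continuity the resulting inequalities
and distance bounds persist on a neighbourhood `U'`. -/
theorem exists_cantor_step (hrel : ∀ x y, E x y ↔ ∃ i, γ i x = y) {K : Set X}
    (hK : ∀ U : Set X, IsOpen U → (U ∩ K).Nonempty → ∃ x ∈ U ∩ K, {y | y ∈ U ∧ E x y}.Infinite)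
    {U : Set X} (hU : IsOpen U) (hUK : (U ∩ K).Nonempty) {W : Set (X ≃ₜ X)} (hW : W.Finite)
    (n : ℕ) {ε : ℝ} (hε : 0 < ε) :
    ∃ (g : X ≃ₜ X) (U' : Set X), (∀ x, E x (g x)) ∧ IsOpen U' ∧ (U' ∩ K).Nonempty ∧
      closure U' ⊆ U ∧ g '' closure U' ⊆ U ∧
      (∀ w ∈ W, ∀ y ∈ U', ∀ y' ∈ U', dist (w y) (w y') ≤ ε ∧ dist (w (g y)) (w (g y')) ≤ ε) ∧
      ∀ w ∈ W, ∀ v ∈ W, ∀ y ∈ U', ∀ y' ∈ U',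
        w y ≠ v (g y') ∧ ∀ j ≤ n, γ j (w y) ≠ v (g y') := by
  obtain ⟨x, ⟨hxU, hxK⟩, hinf⟩ := hK U hU hUK
  let Bad : Set X := ⋃ w ∈ W, ⋃ v ∈ W, ({v.symm (w x)} ∪
    ⋃ j ∈ Finset.range (n + 1), {v.symm (γ j (w x))})
  have hBad : Bad.Finite := hW.biUnion fun w _ => hW.biUnion fun v _ =>
    (finite_singleton _).union ((Finset.finite_toSet _).biUnion fun j _ => finite_singleton _)
  obtain ⟨z, ⟨hzU, hxz⟩, hzB⟩ := (hinf.sdiff hBad).nonempty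
  obtain ⟨i, rfl⟩ := (hrel x z).1 hxz
  have hb1 : ∀ w ∈ W, ∀ v ∈ W, w x ≠ v (γ i x) := by
    intro w hw v hv h
    refine hzB (mem_iUnion₂.2 ⟨w, hw, mem_iUnion₂.2 ⟨v, hv, Or.inl ?_⟩⟩)
    rw [h]; simp
  have hb2 : ∀ w ∈ W, ∀ v ∈ W, ∀ j ≤ n, γ j (w x) ≠ v (γ i x) := by
    intro w hw v hv j hj h
    refine hzB (mem_iUnion₂.2 ⟨w, hw, mem_iUnion₂.2 ⟨v, hv, Or.inr
      (mem_iUnion₂.2 ⟨j, Finset.mem_range.2 (by omega), ?_⟩)⟩⟩)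
    rw [h]; simp
  have hev : ∀ᶠ p : X × X in 𝓝 (x, x),
      (∀ w ∈ W, dist (w p.1) (w p.2) < ε ∧ dist (w (γ i p.1)) (w (γ i p.2)) < ε) ∧
      ∀ w ∈ W, ∀ v ∈ W, w p.1 ≠ v (γ i p.2) ∧
        ∀ j ∈ Finset.range (n + 1), γ j (w p.1) ≠ v (γ i p.2) := by
    have hne : ∀ a b : X ≃ₜ X, a x ≠ b x → ∀ᶠ p : X × X in 𝓝 (x, x), a p.1 ≠ b p.2 := by
      intro a b hab
      have h1 : IsOpen {p : X × X | a p.1 ≠ b p.2} :=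
        isOpen_ne_fun (a.continuous.comp continuous_fst) (b.continuous.comp continuous_snd)
      exact h1.mem_nhds hab
    have hd : ∀ a : X ≃ₜ X, ∀ᶠ p : X × X in 𝓝 (x, x), dist (a p.1) (a p.2) < ε := by
      intro a
      have h1 : IsOpen {p : X × X | dist (a p.1) (a p.2) < ε} :=
        isOpen_lt ((a.continuous.comp continuous_fst).dist (a.continuous.comp continuous_snd))
          continuous_const
      exact h1.mem_nhds (by simpa using hε)
    refine Filter.Eventually.and ?_ ?_
    · exact (eventually_all_finite hW).2 fun w _ => (hd w).and (hd ((γ i).trans w))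
    · refine (eventually_all_finite hW).2 fun w hw => (eventually_all_finite hW).2 fun v hv => ?_
      refine (hne w ((γ i).trans v) (hb1 w hw v hv)).and ?_
      refine (eventually_all_finset _).2 fun j hj => ?_
      exact hne (w.trans (γ j)) ((γ i).trans v)
        (hb2 w hw v hv j (by have := Finset.mem_range.1 hj; omega))
  rw [nhds_prod_eq] at hev
  obtain ⟨S, hS, hSp'⟩ := mem_prod_self_iff.1 hev
  have hSp := fun y hy y' hy' => hSp' (mk_mem_prod (a := y) (b := y') hy hy')
  have hN : S ∩ (U ∩ γ i ⁻¹' U) ∈ 𝓝 x := inter_mem hS (inter_mem (hU.mem_nhds hxU)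
    ((hU.preimage (γ i).continuous).mem_nhds hzU))
  obtain ⟨C, hC, hCc, hCs⟩ := exists_mem_nhds_isClosed_subset hN
  have hcl : closure (interior C) ⊆ C := closure_minimal interior_subset hCc
  have hSC : ∀ y ∈ interior C, y ∈ S := fun y hy => (hCs (interior_subset hy)).1
  refine ⟨γ i, interior C, fun y => (hrel y _).2 ⟨i, rfl⟩, isOpen_interior,
    ⟨x, mem_interior_iff_mem_nhds.2 hC, hxK⟩, fun y hy => (hCs (hcl hy)).2.1, ?_, ?_, ?_⟩
  · rintro _ ⟨y, hy, rfl⟩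
    exact (hCs (hcl hy)).2.2
  · intro w hw y hy y' hy'
    have := (hSp y (hSC y hy) y' (hSC y' hy')).1 w hw
    exact ⟨this.1.le, this.2.le⟩
  · intro w hw v hv y hy y' hy'
    have := (hSp y (hSC y hy) y' (hSC y' hy')).2 w hw v hv
    exact ⟨this.1, fun j hj => this.2 j (Finset.mem_range.2 (by omega))⟩

/-- The word `w α n` composes those `h k`, `k < n`, with `α k = true`, and `f α` is the point of the
shrinking sets `w α n '' U n`. A finite change of `α` changes `f α` by a fixed word that preserves
classes. A difference at coordinate `n` excludes every `γ j` with `j ≤ n` from carrying the branch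
with bit `false` to the other, so infinitely many differences exclude equivalence. -/
theorem exists_cantor_embedding [CompleteSpace X] [MeasurableSpace X] [BorelSpace X]
    (hrel : ∀ x y, E x y ↔ ∃ i, γ i x = y) {K : Set X} (hKne : K.Nonempty)
    (hK : ∀ U : Set X, IsOpen U → (U ∩ K).Nonempty →
      ∃ x ∈ U ∩ K, {y | y ∈ U ∧ E x y}.Infinite) :
    ∃ f : (ℕ → Bool) → X, Measurable f ∧ Function.Injective f ∧
      ∀ α β, E (f α) (f β) ↔ {n | α n ≠ β n}.Finite := by
  classical
  let St := {S : Set X × Set (X ≃ₜ X) // IsOpen S.1 ∧ (S.1 ∩ K).Nonempty ∧ S.2.Finite ∧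
    ∀ w ∈ S.2, ∀ x, E x (w x)}
  have step : ∀ (n : ℕ) (S : St), ∃ (g : X ≃ₜ X) (S' : St),
      closure S'.1.1 ⊆ S.1.1 ∧ g '' closure S'.1.1 ⊆ S.1.1 ∧
      (∀ w ∈ S.1.2, w ∈ S'.1.2 ∧ g.trans w ∈ S'.1.2) ∧
      (∀ w ∈ S'.1.2, ∀ y ∈ S'.1.1, ∀ y' ∈ S'.1.1, dist (w y) (w y') ≤ (1 / 2) ^ n) ∧
      ∀ w ∈ S.1.2, ∀ v ∈ S.1.2, ∀ y ∈ S'.1.1, ∀ y' ∈ S'.1.1,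
        w y ≠ v (g y') ∧ ∀ j ≤ n, γ j (w y) ≠ v (g y') := by
    rintro n ⟨⟨U, W⟩, hU, hUK, hW, hWE⟩
    obtain ⟨g, U', h1, h2, h3, h4, h5, h6, h7⟩ := exists_cantor_step hrel hK hU hUK hW n
      (ε := (1 / 2) ^ n) (by positivity)
    refine ⟨g, ⟨⟨U', W ∪ (fun w => g.trans w) '' W⟩, h2, h3, hW.union (hW.image _), ?_⟩, h4, h5,
      fun w hw => ⟨Or.inl hw, Or.inr ⟨w, hw, rfl⟩⟩, ?_, h7⟩
    · rintro _ (hw | ⟨w, hw, rfl⟩) x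
      · exact hWE _ hw x
      · exact E.trans (h1 x) (hWE w hw (g x))
    · rintro _ (hw | ⟨w, hw, rfl⟩) y hy y' hy'
      · exact (h6 _ hw y hy y' hy').1
      · exact (h6 w hw y hy y' hy').2
  choose g nxt hs1 hs2 hs3 hs4 hs5 using step
  let S : ℕ → St := fun n => Nat.rec
    ⟨⟨univ, {Homeomorph.refl X}⟩, isOpen_univ, by simpa using hKne, finite_singleton _,
      fun w hw x => by rw [hw]; exact E.refl x⟩ (fun n S => nxt n S) n
  let U : ℕ → Set X := fun n => (S n).1.1
  let h : ℕ → X ≃ₜ X := fun n => g n (S n)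
  have hU1 : ∀ n, closure (U (n + 1)) ⊆ U n := fun n => hs1 n (S n)
  have hU2 : ∀ n, h n '' closure (U (n + 1)) ⊆ U n := fun n => hs2 n (S n)
  have hne : ∀ n, ∃ p, p ∈ U n := fun n => (S n).2.2.1.imp fun _ hp => hp.1
  choose p hp using hne
  let w : (ℕ → Bool) → ℕ → X ≃ₜ X := fun α n =>
    Nat.rec (Homeomorph.refl X) (fun n v => if α n then (h n).trans v else v) n
  have hw : ∀ α n, w α (n + 1) = if α n then (h n).trans (w α n) else w α n := fun α n => rfl
  have hwW : ∀ α n, w α n ∈ (S n).1.2 := by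
    intro α n
    induction n with
    | zero => exact rfl
    | succ n ih =>
      rw [hw]
      split_ifs
      · exact (hs3 n (S n) _ ih).2
      · exact (hs3 n (S n) _ ih).1
  have hwE : ∀ α n x, E x (w α n x) := fun α n x => (S n).2.2.2.2 _ (hwW α n) x
  have hdist : ∀ α n, ∀ a ∈ w α (n + 1) '' U (n + 1), ∀ b ∈ w α (n + 1) '' U (n + 1),
      dist a b ≤ (1 / 2) ^ n := by
    rintro α n _ ⟨a, ha, rfl⟩ _ ⟨b, hb, rfl⟩
    exact hs4 n (S n) _ (hwW α (n + 1)) a ha b hb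
  have hclos : ∀ α n, closure (w α (n + 1) '' U (n + 1)) ⊆ w α n '' U n := by
    intro α n
    rw [← Homeomorph.image_closure, hw]
    rintro _ ⟨y, hy, rfl⟩
    split_ifs
    · exact ⟨h n y, hU2 n ⟨y, hy, rfl⟩, rfl⟩
    · exact ⟨y, hU1 n hy, rfl⟩
  have hanti : ∀ α, Antitone fun n => w α n '' U n := fun α =>
    antitone_nat_of_succ_le fun n => subset_closure.trans (hclos α n)
  have hmem : ∀ α n, w α n (p n) ∈ w α n '' U n := fun α n => mem_image_of_mem _ (hp n)
  have hcauchy : ∀ α, CauchySeq fun n => w α n (p n) := by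
    intro α
    refine (cauchySeq_shift (k := 1)).1 <| cauchySeq_of_le_geometric (1 / 2) 1 (by norm_num)
      fun n => ?_
    rw [one_mul]
    exact hdist α n _ (hmem α (n + 1)) _ (hanti α (Nat.le_succ (n + 1)) (hmem α (n + 1 + 1)))
  choose f hf using fun α => cauchySeq_tendsto_of_complete (hcauchy α)
  have hfU : ∀ α n, f α ∈ w α n '' U n := by
    intro α n
    refine hclos α n (mem_closure_of_tendsto (hf α) ?_)
    filter_upwards [eventually_ge_atTop (n + 1)] with m hm
    exact hanti α hm (hmem α m)
  have huniq : ∀ α N a, (∀ n ≥ N, a ∈ w α n '' U n) → a = f α := by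
    intro α N a ha
    refine dist_le_zero.1 (ge_of_tendsto (tendsto_pow_atTop_nhds_zero_of_lt_one
      (r := (1 / 2 : ℝ)) (by norm_num) (by norm_num)) ?_)
    filter_upwards [eventually_ge_atTop N] with n hn
    exact hdist α n _ (ha (n + 1) (by omega)) _ (hfU α (n + 1))
  have hsep : ∀ α β n, α n = false → β n = true → f α ≠ f β ∧ ∀ j ≤ n, γ j (f α) ≠ f β := by
    intro α β n hα hβ
    obtain ⟨y, hy, hyα⟩ := hfU α (n + 1)
    obtain ⟨z, hz, hzβ⟩ := hfU β (n + 1)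
    rw [hw, hα] at hyα
    rw [hw, hβ] at hzβ
    rw [← hyα, ← hzβ]
    exact hs5 n (S n) _ (hwW α n) _ (hwW β n) y hy z hz
  refine ⟨f, ?_, ?_, fun α β => ⟨fun hE => ?_, fun hfin => ?_⟩⟩
  · refine measurable_of_tendsto_metrizable (f := fun n α => w α n (p n)) (fun n => ?_)
      (tendsto_pi_nhds.2 hf)
    suffices H : ∀ n x, Measurable fun α => w α n x from H n (p n)
    intro n
    induction n with
    | zero => exact fun x => measurable_const
    | succ n ih =>
      intro x
      have : (fun α => w α (n + 1) x) = fun α => if α n = true then w α n (h n x) else w α n x := by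
        funext α
        rw [hw]
        split_ifs <;> rfl
      rw [this]
      have hn : MeasurableSet {α : ℕ → Bool | α n = true} :=
        (measurable_pi_apply (X := fun _ => Bool) n) (measurableSet_singleton true)
      exact Measurable.ite hn (ih _) (ih _)
  · intro α β hαβ
    funext n
    cases h1 : α n <;> cases h2 : β n
    · rfl
    · exact absurd hαβ (hsep α β n h1 h2).1
    · exact absurd hαβ.symm (hsep β α n h2 h1).1
    · rfl
  · by_contra hinf
    obtain ⟨i, hi⟩ := (hrel _ _).1 hE
    obtain ⟨j, hj⟩ := (hrel _ _).1 (E.symm hE)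
    -- Separation works only from bit `false` to bit `true`, so elements for both directions must be
    -- excluded.
    obtain ⟨n, hn, hlt⟩ := Set.Infinite.exists_gt hinf (max i j)
    have hn' : α n ≠ β n := hn
    cases h1 : α n <;> cases h2 : β n
    · exact hn' (h1.trans h2.symm)
    · exact (hsep α β n h1 h2).2 i ((le_max_left i j).trans hlt.le) hi
    · exact (hsep β α n h2 h1).2 j ((le_max_right i j).trans hlt.le) hj
    · exact hn' (h1.trans h2.symm)
  · obtain ⟨N, hN⟩ := hfin.bddAbove
    have heq : ∀ n > N, α n = β n := fun n hn => by
      by_contra hne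
      exact absurd (hN hne) (not_le.2 hn)
    -- Past `N` both words continue with the same factors on the right, so they differ by one fixed
    -- homeomorphism on the left.
    have key : ∀ k x, w β (N + 1 + k) x =
        w β (N + 1) ((w α (N + 1)).symm (w α (N + 1 + k) x)) := by
      intro k
      induction k with
      | zero => intro x; simp
      | succ k ih =>
        intro x
        have hlt : N < N + 1 + k := by omega
        change w β (N + 1 + k + 1) x = w β (N + 1) ((w α (N + 1)).symm (w α (N + 1 + k + 1) x))
        rw [hw β (N + 1 + k), hw α (N + 1 + k), heq _ hlt]
        split_ifs
        · exact ih (h (N + 1 + k) x)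
        · exact ih x
    have hfβ : w β (N + 1) ((w α (N + 1)).symm (f α)) = f β := by
      refine huniq β (N + 1) _ fun n hn => ?_
      obtain ⟨k, rfl⟩ := Nat.exists_eq_add_of_le hn
      obtain ⟨y, hy, hyα⟩ := hfU α (N + 1 + k)
      exact ⟨y, hy, by rw [key, hyα]⟩
    have h1 := hwE α (N + 1) ((w α (N + 1)).symm (f α))
    rw [Homeomorph.apply_symm_apply] at h1
    rw [← hfβ]
    exact E.trans (E.symm h1) (hwE β (N + 1) _)

end embedding


theorem IsSmoothOn.mono {X : Type*} [MeasurableSpace X] {E : Setoid X} {V V' : Set X}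
    (h : IsSmoothOn E V) (hV : V' ⊆ V) : IsSmoothOn E V' := by
  obtain ⟨s, hs, hsE⟩ := h
  exact ⟨s, hs, fun x hx y hy => hsE x (hV hx) y (hV hy)⟩

/-- The points of a nonsmooth relation outside a suitable smooth open set recur infinitely often
to every neighbourhood. -/
theorem isSmoothOn_univ_or_exists_recurrent {X : Type*} [TopologicalSpace X]
    [SecondCountableTopology X] [MeasurableSpace X] [BorelSpace X] [StandardBorelSpace X]
    {E : Setoid X} (hE : IsCBER E) :
    IsSmoothOn E univ ∨ ∃ K : Set X, K.Nonempty ∧ ∀ U : Set X, IsOpen U → (U ∩ K).Nonempty →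
      ∃ x ∈ U ∩ K, {y | y ∈ U ∧ E x y}.Infinite := by
  obtain ⟨γ, hγ⟩ := hE.exists_isGen
  obtain ⟨B, hBc, -, hB⟩ := TopologicalSpace.exists_countable_basis X
  let sat : Set X → Set X := fun U => {x | ∃ y, E x y ∧ y ∈ U}
  have hsatinv : ∀ U x y, E x y → x ∈ sat U → y ∈ sat U := by
    rintro U x y hxy ⟨z, hxz, hz⟩
    exact ⟨z, E.trans (E.symm hxy) hxz, hz⟩
  -- The empty set makes `J` nonempty, so that it can be enumerated by `ℕ`.
  let J : Set (Set X) := insert ∅ {b ∈ B | IsSmoothOn E (sat b)}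
  have hJc : J.Countable := (hBc.mono (sep_subset _ _)).insert _
  obtain ⟨b, hb⟩ := hJc.exists_eq_range (insert_nonempty _ _)
  have hbm : ∀ n, MeasurableSet (sat (b n)) := by
    intro n
    refine hγ.measurableSet_exists ?_
    have : b n ∈ J := hb ▸ mem_range_self n
    rcases this with h | h
    · rw [h]; exact .empty
    · exact (hB.isOpen h.1).measurableSet
  have hbs : ∀ n, IsSmoothOn E (sat (b n)) := by
    intro n
    have : b n ∈ J := hb ▸ mem_range_self n
    rcases this with h | h
    · rw [h]
      refine ⟨fun _ => 0, measurable_const, ?_⟩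
      rintro x ⟨y, -, hy⟩
      exact absurd hy (notMem_empty y)
    · exact h.2
  let V : Set X := ⋃ n, sat (b n)
  have hVm : MeasurableSet V := .iUnion hbm
  have hVinv : ∀ x y, E x y → x ∈ V → y ∈ V := by
    intro x y hxy hx
    obtain ⟨n, hn⟩ := mem_iUnion.1 hx
    exact mem_iUnion.2 ⟨n, hsatinv _ _ _ hxy hn⟩
  have hVs : IsSmoothOn E V := isSmoothOn_iUnion hbm (fun n => hsatinv _) hbs
  by_cases hVu : V = univ
  · exact Or.inl (hVu ▸ hVs)
  refine Or.inr ⟨Vᶜ, nonempty_compl.2 hVu, fun U hU ⟨x, hxU, hxK⟩ => ?_⟩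
  by_contra! hcon
  have hsatm : MeasurableSet (sat U) := hγ.measurableSet_exists hU.measurableSet
  have h1 : IsSmoothOn E (sat U ∩ Vᶜ) := by
    refine hE.isSmoothOn_of_finite hU.measurableSet (fun z hz => ?_) fun z hz => ?_
    · obtain ⟨y, hzy, hy⟩ := hz.1
      exact ⟨y, hy, hzy⟩
    · obtain ⟨y, hzy, hy⟩ := hz.1
      have hyK : y ∉ V := fun h => hz.2 (hVinv _ _ (E.symm hzy) h)
      refine (hcon y ⟨hy, hyK⟩).subset fun a ha => ⟨ha.1, E.trans (E.symm hzy) ha.2⟩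
  -- Smoothness on `sat U` puts a basic neighbourhood of `x` in `J`, hence `x` in `V`, contradicting
  -- the choice of `x`.
  have h2 : IsSmoothOn E (sat U) := by
    let D : ℕ → Set X := fun n => Nat.casesOn n V (fun _ => sat U ∩ Vᶜ)
    refine IsSmoothOn.mono (V := ⋃ n, D n) (isSmoothOn_iUnion ?_ ?_ ?_) ?_
    · rintro (_ | n)
      exacts [hVm, hsatm.inter hVm.compl]
    · rintro (_ | n) a c hac ha
      · exact hVinv a c hac ha
      · exact ⟨hsatinv _ _ _ hac ha.1, fun h => ha.2 (hVinv _ _ (E.symm hac) h)⟩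
    · rintro (_ | n)
      exacts [hVs, h1]
    · intro a ha
      by_cases haV : a ∈ V
      · exact mem_iUnion.2 ⟨0, haV⟩
      · exact mem_iUnion.2 ⟨1, ha, haV⟩
  obtain ⟨c, hcB, hxc, hcU⟩ := hB.exists_subset_of_mem_open hxU hU
  have hcJ : c ∈ J := Or.inr ⟨hcB, h2.mono fun a ⟨y, hay, hy⟩ => ⟨y, hay, hcU hy⟩⟩
  rw [hb] at hcJ
  obtain ⟨n, rfl⟩ := hcJ
  exact hxK (mem_iUnion.2 ⟨n, x, E.refl x, hxc⟩)

/-- **Glimm–Effros dichotomy** for countable Borel equivalence relations. -/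
theorem IsCBER.isSmoothOn_univ_or_exists_embedding {X : Type*} [MeasurableSpace X]
    [StandardBorelSpace X] {E : Setoid X} (hE : IsCBER E) :
    IsSmoothOn E univ ∨ ∃ f : (ℕ → Bool) → X, Measurable f ∧ Function.Injective f ∧
      ∀ α β, E (f α) (f β) ↔ {n | α n ≠ β n}.Finite := by
  obtain ⟨γ, hγ⟩ := hE.exists_isGen
  obtain ⟨t, hp, hb, hcont⟩ := exists_polish_continuous hγ.measurable
  let := TopologicalSpace.upgradeIsCompletelyMetrizable X
  refine (isSmoothOn_univ_or_exists_recurrent hE).imp_right ?_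
  rintro ⟨K, hKne, hK⟩
  let g : ℕ → X ≃ₜ X := fun i =>
    { toFun := γ i
      invFun := γ i
      left_inv := hγ.invol i
      right_inv := hγ.invol i
      continuous_toFun := hcont i
      continuous_invFun := hcont i }
  exact exists_cantor_embedding (γ := g) hγ.rel hKne hK

/-! ### Absorption for hyperfinite relations. -/

theorem IsHyperfinite.prod_bot {X : Type*} [MeasurableSpace X] {E : Setoid X}
    (h : IsHyperfinite E) : IsHyperfinite (E.prod (⊥ : Setoid ℕ)) := by
  obtain ⟨F, hFm, hFf, hFs, hFE⟩ := h
  refine ⟨fun n => (F n).prod ⊥, fun n => ?_, fun n p => ?_, fun n p q h => ⟨hFs _ _ _ h.1, h.2⟩,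
    fun p q => ⟨?_, ?_⟩⟩
  · refine MeasurableSet.inter (s₁ := {p : (X × ℕ) × (X × ℕ) | F n p.1.1 p.2.1})
      (s₂ := {p : (X × ℕ) × (X × ℕ) | p.1.2 = p.2.2}) ?_ ?_
    · exact ((measurable_fst.comp measurable_fst).prodMk (measurable_fst.comp measurable_snd))
        (hFm n)
    · exact measurableSet_eq_fun (measurable_snd.comp measurable_fst)
        (measurable_snd.comp measurable_snd)
  · refine ((hFf n p.1).image fun x => (x, p.2)).subset ?_
    rintro ⟨y, m⟩ ⟨h1, h2⟩
    exact ⟨y, h1, Prod.ext rfl h2⟩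
  · rintro ⟨h1, h2⟩
    obtain ⟨n, hn⟩ := (hFE _ _).1 h1
    exact ⟨n, hn, h2⟩
  · rintro ⟨n, h1, h2⟩
    exact ⟨(hFE _ _).2 ⟨n, h1⟩, h2⟩

/-- A natural number stored as the indicator of one point affects only finitely many bits: a
reduction can thus be made injective at no cost. -/
theorem finite_setOf_sumElim_ne_iff {ι : Type*} (a b : ι → Bool) (m n : ℕ) :
    {i | Sum.elim a (fun k => decide (k = m)) i ≠ Sum.elim b (fun k => decide (k = n)) i}.Finite ↔
      {i | a i ≠ b i}.Finite := by
  constructor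
  · intro h
    exact h.preimage (f := Sum.inl) Sum.inl_injective.injOn
  · intro h
    refine ((h.image Sum.inl).union (({m, n} : Set ℕ).toFinite.image Sum.inr)).subset ?_
    rintro (i | k) hi
    · exact Or.inl ⟨i, hi, rfl⟩
    · refine Or.inr ⟨k, ?_, rfl⟩
      by_contra hk
      simp only [mem_insert_iff, mem_singleton_iff, not_or] at hk
      simp [hk.1, hk.2] at hi

/-- A nonsmooth hyperfinite relation absorbs countably many copies of `E × I_ℕ`. -/
theorem IsHyperfinite.absorbsProdNat_of_embedding {X : Type*} [MeasurableSpace X]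
    [StandardBorelSpace X] {E : Setoid X} (hE : IsCBER E) (hF : IsHyperfinite E)
    {f : (ℕ → Bool) → X} (hf : Measurable f) (hfi : Function.Injective f)
    (hfE : ∀ α β, E (f α) (f β) ↔ {n | α n ≠ β n}.Finite) : AbsorbsProdNat E := by
  obtain ⟨h, hh, hhE⟩ := hF.prod_bot.exists_reduction
  have hhE' : ∀ p q : X × ℕ, (E p.1 q.1 ∧ p.2 = q.2) ↔ {i | h p i ≠ h q i}.Finite := hhE
  have hcount : ∀ r, (h ⁻¹' {r}).Countable := by
    intro r
    rcases (h ⁻¹' {r}).eq_empty_or_nonempty with he | ⟨p, hp⟩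
    · rw [he]; exact countable_empty
    · refine ((hE.countable_class p.1).image fun x => (x, p.2)).mono fun q hq => ?_
      have hpq : h p = h q := Eq.trans hp (Eq.symm hq)
      have := (hhE' p q).2 (by simp [hpq])
      exact ⟨q.1, this.1, Prod.ext rfl this.2⟩
  obtain ⟨j, hj, hji⟩ := exists_label hh hcount
  obtain ⟨e⟩ : Nonempty ((ℕ × ℕ × ℕ × List Bool) ⊕ ℕ ≃ ℕ) := nonempty_equiv_of_countable
  -- The copy number `p.2.1` enters the reduction `h`, so distinct copies stay unrelated. The label
  -- `j` and the `I_ℕ` coordinate enter only as one marked bit.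
  let c : X × ℕ × ℕ → ((ℕ × ℕ × ℕ × List Bool) ⊕ ℕ → Bool) := fun p =>
    Sum.elim (h (p.1, p.2.1)) fun k => decide (k = Nat.pair (j (p.1, p.2.1)) p.2.2)
  have hpr : Measurable fun p : X × ℕ × ℕ => (p.1, p.2.1) :=
    measurable_fst.prodMk (measurable_fst.comp measurable_snd)
  have hc : Measurable c := by
    refine measurable_pi_lambda _ ?_
    rintro (i | k)
    · exact (measurable_pi_apply i).comp (hh.comp hpr)
    · have h1 : Measurable fun q : ℕ × ℕ => decide (k = Nat.pair q.1 q.2) :=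
        measurable_of_countable _
      exact h1.comp ((hj.comp hpr).prodMk (measurable_snd.comp measurable_snd))
  refine ⟨fun p => f fun n => c p (e.symm n), ?_, ?_, fun p q => ?_⟩
  · exact hf.comp (measurable_pi_lambda _ fun n => (measurable_pi_apply _).comp hc)
  · intro p q hpq
    have h1 : c p = c q := funext fun i => by
      have := congrFun (hfi hpq) (e i)
      simpa using this
    have h2 : h (p.1, p.2.1) = h (q.1, q.2.1) := funext fun i => congrFun h1 (.inl i)
    have h3 : Nat.pair (j (p.1, p.2.1)) p.2.2 = Nat.pair (j (q.1, q.2.1)) q.2.2 := by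
      have := congrFun h1 (.inr (Nat.pair (j (p.1, p.2.1)) p.2.2))
      simpa [c] using this
    rw [Nat.pair_eq_pair] at h3
    have h4 := hji (Prod.ext h2 h3.1)
    simp only [Prod.mk.injEq] at h4
    exact Prod.ext h4.1 (Prod.ext h4.2 h3.2)
  · rw [hfE, hhE' (p.1, p.2.1) (q.1, q.2.1),
      ← finite_setOf_sumElim_ne_iff (h (p.1, p.2.1)) (h (q.1, q.2.1))
        (Nat.pair (j (p.1, p.2.1)) p.2.2) (Nat.pair (j (q.1, q.2.1)) q.2.2)]
    constructor
    · intro hfin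
      refine (hfin.preimage (f := e) e.injective.injOn).subset fun i hi => ?_
      simpa [c] using hi
    · intro hfin
      exact hfin.preimage (f := e.symm) e.symm.injective.injOn

/-- Countable spaces need only a bijection; uncountable standard Borel spaces are all isomorphic. -/
theorem exists_measurableEquiv_prod_nat (S : Type*) [MeasurableSpace S] [StandardBorelSpace S]
    [Infinite S] : Nonempty (S × ℕ ≃ᵐ S) := by
  by_cases h : Countable S
  · obtain ⟨e⟩ : Nonempty (S × ℕ ≃ S) := nonempty_equiv_of_countable
    exact ⟨⟨e, measurable_of_countable _, measurable_of_countable _⟩⟩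
  · refine ⟨PolishSpace.measurableEquivOfNotCountable (fun h' => h ?_) h⟩
    exact (Prod.mk_left_injective (α := S) (0 : ℕ)).countable

/-- A smooth aperiodic relation with infinitely many classes absorbs countably many copies of
`E × I_ℕ`. -/
theorem IsSmoothOn.absorbsProdNat {X : Type*} [MeasurableSpace X] [StandardBorelSpace X]
    {E : Setoid X} (hE : IsCBER E) (hap : IsAperiodic E) (hs : IsSmoothOn E univ)
    [Infinite (Quotient E)] : AbsorbsProdNat E := by
  obtain ⟨κ, hκ, hκi, hκE⟩ := (hE.isCompressible_of_isSmoothOn hap hs).exists_prod_nat hE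
  obtain ⟨l, hl, hli⟩ := hE.exists_label_of_isSmoothOn hs
  obtain ⟨s, hsm, hsE⟩ := hs
  have hsE' : ∀ x y, E x y ↔ s x = s y := fun x y => hsE x trivial y trivial
  have hcount := hE.countable_fibre fun x y h => (hsE' x y).2 h
  have hR := measurableSet_range_of_countable_fibre hsm hcount
  have := hR.standardBorel
  let s' : X → range s := rangeFactorization s
  have hs'm : Measurable s' := hsm.subtype_mk
  have hs'E : ∀ x y, E x y ↔ s' x = s' y := fun x y => by
    rw [hsE', Subtype.ext_iff]; rfl
  have hne : Nonempty X := (inferInstance : Nonempty (Quotient E)).map Quotient.out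
  obtain ⟨t, ht, hts⟩ := exists_section hs'm (hE.countable_fibre fun x y h => (hs'E x y).2 h)
  have hts' : ∀ r, s' (t r) = r := by
    rintro ⟨_, x, rfl⟩; exact hts x
  have : Infinite (range s) := by
    refine Infinite.of_injective (fun q : Quotient E => s' q.out) fun q q' h => ?_
    rw [← q.out_eq, ← q'.out_eq]
    exact Quotient.sound ((hs'E _ _).2 h)
  -- `range s` is the space of classes, so `θ` assigns to each class and copy number a class of its
  -- own. Compressibility then fits `X`-labels and the `I_ℕ` coordinate into that class.
  obtain ⟨θ⟩ := exists_measurableEquiv_prod_nat (range s)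
  have hpair : Measurable fun q : ℕ × ℕ => Nat.pair q.1 q.2 := measurable_of_countable _
  have hrel : ∀ p q : X × ℕ × ℕ, E (t (θ (s' p.1, p.2.1))) (t (θ (s' q.1, q.2.1))) ↔
      E p.1 q.1 ∧ p.2.1 = q.2.1 := by
    intro p q
    rw [hs'E, hts', hts', θ.injective.eq_iff, Prod.mk.injEq, ← hs'E]
  refine ⟨fun p => κ (t (θ (s' p.1, p.2.1)), Nat.pair (l p.1) p.2.2), ?_, ?_, fun p q => ?_⟩
  · exact hκ.comp ((ht.comp (θ.measurable.comp ((hs'm.comp measurable_fst).prodMk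
      (measurable_fst.comp measurable_snd)))).prodMk (hpair.comp ((hl.comp measurable_fst).prodMk
      (measurable_snd.comp measurable_snd))))
  · intro p q hpq
    have h1 := hκi hpq
    rw [Prod.mk.injEq, Nat.pair_eq_pair] at h1
    have h2 := (hrel p q).1 (by rw [h1.1])
    exact Prod.ext (hli _ _ h2.1 h1.2.1) (Prod.ext h2.2 h1.2.2)
  · rw [← hrel]
    have h1 := hκE (t (θ (s' p.1, p.2.1)), Nat.pair (l p.1) p.2.2)
    have h2 := hκE (t (θ (s' q.1, q.2.1)), Nat.pair (l q.1) q.2.2)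
    exact ⟨fun h => E.trans h1 (E.trans h (E.symm h2)), fun h => E.trans (E.symm h1) (E.trans h h2)⟩

theorem IsHyperfinite.absorbsProdNat {X : Type*} [MeasurableSpace X] [StandardBorelSpace X]
    {E : Setoid X} (hE : IsCBER E) (hap : IsAperiodic E) (hF : IsHyperfinite E)
    (hQ : IsEmpty X ∨ Infinite (Quotient E)) : AbsorbsProdNat E := by
  rcases hQ with hX | hQ
  · exact ⟨fun p => p.1, measurable_fst, fun p => isEmptyElim p.1, fun p => isEmptyElim p.1⟩
  rcases hE.isSmoothOn_univ_or_exists_embedding with hs | ⟨f, hf, hfi, hfE⟩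
  · exact hs.absorbsProdNat hE hap
  · exact hF.absorbsProdNat_of_embedding hE hf hfi hfE

/-- Here `X` is countable, so any numbering of the classes is a Borel invariant and `E` is smooth.
-/
theorem IsCBER.isCompressible_of_finite_quotient {X : Type*} [MeasurableSpace X]
    [StandardBorelSpace X] {E : Setoid X} (hE : IsCBER E) (hap : IsAperiodic E)
    [Finite (Quotient E)] : IsCompressible E := by
  have : Countable X := by
    rw [← countable_univ_iff]
    refine (countable_iUnion fun q : Quotient E => hE.countable_class q.out).mono fun x _ => ?_
    exact mem_iUnion.2 ⟨Quotient.mk E x, Quotient.exact (Quotient.out_eq _)⟩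
  obtain ⟨e, he⟩ := exists_injective_nat (Quotient E)
  refine hE.isCompressible_of_isSmoothOn hap ⟨fun x => (e (Quotient.mk E x) : ℝ),
    measurable_of_countable _, fun x _ y _ => ?_⟩
  rw [Nat.cast_inj, he.eq_iff, Quotient.eq]

end CBER

end

/-! ### The equivalence and the absorption statement. -/

theorem mainTheorem6 {X : Type*} [MeasurableSpace X] [StandardBorelSpace X]
    (E : Setoid X) (hE : CBER.IsCBER E) (hap : CBER.IsAperiodic E) :
    ((CBER.BorelIso E (CBER.directSum E (CBER.prodNat E)) ∨ CBER.IsHyperfinite E) →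
      List.TFAE
        [ ∀ (G : Type) [Group G] [Countable G] (a : G →* Equiv.Perm (Quotient E)),
            CBER.IsBorelAction E a →
              ∃ b : G →* CBER.autB E, CBER.IsLift E a b ∧ CBER.IsClassBijective E b,
          ∀ (G : Type) [Group G] [Countable G] (a : G →* Equiv.Perm (Quotient E)),
            CBER.IsBorelAction E a → ∃ b : G →* CBER.autB E, CBER.IsLift E a b,
          ∀ (G : Type) [Group G] [Countable G] (a : G →* Equiv.Perm (Quotient E)),
            CBER.IsBorelAction E a → CBER.IsOuterAction E a,
          ∃ (G : Type) (_ : Group G), Countable G ∧ Nontrivial G ∧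
            ∀ a : G →* Equiv.Perm (Quotient E),
              CBER.IsBorelAction E a → CBER.IsOuterAction E a,
          CBER.IsCompressible E ]) ∧
    (CBER.IsHyperfinite E → (IsEmpty X ∨ Infinite (Quotient E)) →
      CBER.BorelIso E (CBER.directSum E (CBER.prodNat E))) := by
  refine ⟨fun h => ?_, fun hF hQ => (hF.absorbsProdNat hE hap hQ).borelIso hE⟩
  tfae_have 1 → 2 := fun h1 G _ _ a ha => (h1 G a ha).imp fun _ hb => hb.1
  tfae_have 2 → 3 := fun h2 G _ _ a ha g => by
    obtain ⟨b, hb⟩ := h2 G a ha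
    exact ⟨b g, hb g⟩
  tfae_have 3 → 4 := fun h3 =>
    ⟨Multiplicative (ZMod 2), inferInstance, inferInstance, inferInstance, fun a ha => h3 _ a ha⟩
  tfae_have 4 → 5 := by
    rintro ⟨G, _, _, _, hG⟩
    rcases h with h | hF
    · exact h.absorbsProdNat.isCompressible_of_outer hE G hG
    -- The absorption argument needs infinitely many classes; with finitely many, `E` is
    -- compressible without using the group.
    by_cases hQ : Infinite (Quotient E)
    · exact (hF.absorbsProdNat hE hap (Or.inr hQ)).isCompressible_of_outer hE G hG
    · have := not_infinite_iff_finite.1 hQ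
      exact hE.isCompressible_of_finite_quotient hap
  tfae_have 5 → 1 := fun h5 G _ _ a ha => h5.exists_lift a hE ha
  tfae_finish
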